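/- Let $L\subset\mathbb R^d$ be a discrete subgroup and $M=\mathbb R^d/L$ with the flat metric ($L=0$ gives $\mathbb R^d$, $L=\mathbb Z^d$ gives the torus). Let $\mathcal D\subset M$ be open; in particular, $\mathcal D$ may be a bounded connected domain whose boundary is a finite union of $C^3$ smooth compact hypersurfaces. Consider the billiard in $\mathcal D$: a point particle moves with constant velocity $v$ in $\mathcal D$ and reflects at boundary points by $v\mapsto v-2\langle v,\nu\rangle\nu$. A boundary point $q$ is regular if it lies on a local $C^3$ hypersurface $\{f=0\}$, $\nabla f(q)\neq0$, that is disjoint from $\mathcal D$ and for which the side $\{f>0\}$ lies in $\mathcal D$ near $q$; the inner unit normal is then $\nu=\nabla f(q)/\|\nabla f(q)\|$. The phase space is $\Omega=\mathcal D\times S^{d-1}$, with tangent spaces $\mathcal T_{(q,v)}\Omega=\{(\delta q,\delta v)\in\mathbb R^d\times\mathbb R^d:\langle\delta v,v\rangle=0\}$ and the Euclidean inner product on them. For $t\in\mathbb R$ the flow map $\Phi^t$ is defined at those $y\in\Omega$ whose orbit between the times $0$ and $t$ has only finitely many collisions, all of them non-grazing ($\langle v,\nu\rangle<0$ for the incoming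 velocity) and at regular boundary points, and which are not at a collision at time $t$. Let $J\subset\Omega$ be a set and $y_0\in J$ a point near which $J$ is an embedded $C^1$ hypersurface of $\Omega$ without boundary (for example, an interior point of a compact smooth locally flow-invariant hypersurface with boundary). Let $n_0\in\mathcal T_{y_0}\Omega$ be a non-zero normal vector to $J$ at $y_0$. Let $t\in\mathbb R$ be such that $\Phi^t$ is defined at $y_0$, and put $y_t=\Phi^t(y_0)$. Then $\Phi^t$ is differentiable at $y_0$, $\Phi^{-t}$ is differentiable at $y_t$, and their derivatives $D_{y_0}\Phi^t:\mathcal T_{y_0}\Omega\to\mathcal T_{y_t}\Omega$ and $D_{y_t}\Phi^{-t}:\mathcal T_{y_t}\Omega\to\mathcal T_{y_0}\Omega$ are inverse to each other. Near $y_t$ the image $J_t=\Phi^t(J)$ is a $C^1$ hypersurface with tangent space $D_{y_0}\Phi^t(\mathcal T_{y_0}J)$, and $$n_t=(D_{y_t}\Phi^{-t})^*(n_0)$$ is a non-zero normal vector to $J_t$ at $y_t$. The flow map $\Phi^t$ expands the volume of $J$ at $y_0$ by the factor $\|n_t\|/\|n_0\|$: with $\mathrm{vol}$ the $(2d-2)$-dimensional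 Hausdorff measure for the Euclidean product metric, every neighbourhood of $y_0$ in $J$ has positive volume, and $$\frac{\mathrm{vol}(\Phi^t(A))}{\mathrm{vol}(A)}\longrightarrow\frac{\|n_t\|}{\|n_0\|}$$ as the set $A\subset J$ with $\mathrm{vol}(A)\ne0$ shrinks to $y_0$ (that is, for each $\varepsilon$-neighbourhood of the limit there is a neighbourhood $U$ of $y_0$ such that the ratio lies in it for all $A\subset J\cap U$ with $\mathrm{vol}(A)\neq0$). -/

import Mathlib

open Set Filter Topology MeasureTheory
open scoped ENNReal RealInnerProductSpace

namespace Billiard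

/-- Euclidean `d`-space. -/
abbrev Euc (d : ℕ) : Type := EuclideanSpace ℝ (Fin d)

/-- The space `ℝ^d × ℝ^d` of vectors `(δq, δv)`, with the Euclidean inner product
`⟪(δq, δv), (z, w)⟫ = ⟪δq, z⟫ + ⟪δv, w⟫`. -/
abbrev Vec (d : ℕ) : Type := WithLp 2 (Euc d × Euc d)

/-- Pairs `(q, v)` of a point `q` of the flat manifold `ℝ^d / L` and a velocity `v ∈ ℝ^d`, with
the product Riemannian distance. Here `L` is a discrete subgroup of `ℝ^d`: `L = 0` gives `ℝ^d`
itself and `L = ℤ^d` gives the torus. -/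
abbrev Phase {d : ℕ} (L : AddSubgroup (Euc d)) : Type := WithLp 2 ((Euc d ⧸ L) × Euc d)

section Basic

variable {d : ℕ} {L : AddSubgroup (Euc d)}

/-- The point `q + x` of `ℝ^d / L`, for `q ∈ ℝ^d / L` and a displacement `x ∈ ℝ^d`. -/
def shift (q : Euc d ⧸ L) (x : Euc d) : Euc d ⧸ L := q + QuotientAddGroup.mk x

/-- The pair `(q + δq, v + δv)`; for fixed `y = (q, v)` and small `p = (δq, δv)` these are the
natural flat coordinates around `y`. -/
def Phase.shift (y : Phase L) (p : Vec d) : Phase L :=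
  WithLp.toLp 2 (Billiard.shift y.fst p.fst, y.snd + p.snd)

/-- The phase space `Ω = D × S^{d-1}` of the billiard in `D`. -/
def phaseSpace (D : Set (Euc d ⧸ L)) : Set (Phase L) := {y | y.fst ∈ D ∧ ‖y.snd‖ = 1}

/-- The displacements `p` for which the shifted pair has unit velocity; these are the flat
coordinates of the points of the unit tangent bundle around `y`. -/
def unitDisplacements (y : Phase L) : Set (Vec d) := {p | ‖y.snd + p.snd‖ = 1}

/-- The tangent space `T_y Ω = {(δq, δv) : ⟪δv, v⟫ = 0}` at `y = (q, v)`. -/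
def tangentSpace (y : Phase L) : Submodule ℝ (Vec d) where
  carrier := {ξ | ⟪ξ.snd, y.snd⟫ = 0}
  add_mem' := by
    intro a b ha hb
    simp only [mem_ofPred_eq, WithLp.add_snd, inner_add_left] at *
    rw [ha, hb, add_zero]
  zero_mem' := by simp
  smul_mem' := by
    intro c a ha
    simp only [mem_ofPred_eq, WithLp.smul_snd, inner_smul_left] at *
    rw [ha, mul_zero]

/-! ### The billiard flow -/

/-- `ν` is a unit normal vector at a regular point `q` of the boundary of `D`, pointing into `D`:
near `q` there is a `C³` hypersurface `{f = 0}` through `q` (in flat coordinates centred at `q`)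
with `ν = ∇f / ‖∇f‖` at `q`, which is disjoint from `D` and whose side `{f > 0}` is contained
in `D`. -/
def IsInnerNormal (D : Set (Euc d ⧸ L)) (q : Euc d ⧸ L) (ν : Euc d) : Prop :=
  ∃ f : Euc d → ℝ, ContDiffAt ℝ 3 f 0 ∧ f 0 = 0 ∧ gradient f 0 ≠ 0 ∧
    ν = ‖gradient f 0‖⁻¹ • gradient f 0 ∧
    ∀ᶠ x in 𝓝 (0 : Euc d), (0 < f x → shift q x ∈ D) ∧ (f x = 0 → shift q x ∉ D)

/-- `Reaches D y t y'`: a billiard particle that starts at `y = (q, v)`, `q ∈ D`, is at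
`y' = (q', v')`, `q' ∈ D`, after time `t ≥ 0`. In between it moves freely inside `D`, except for
finitely many non-grazing collisions at regular boundary points, where the velocity `v` changes
to `v - 2⟪v, ν⟫ν`. -/
inductive Reaches (D : Set (Euc d ⧸ L)) : Phase L → ℝ → Phase L → Prop
  | free (q : Euc d ⧸ L) (v : Euc d) (t : ℝ) (ht : 0 ≤ t)
      (hfree : ∀ s ∈ Icc 0 t, shift q (s • v) ∈ D) :
      Reaches D (WithLp.toLp 2 (q, v)) t (WithLp.toLp 2 (shift q (t • v), v))
  | collide (y : Phase L) (t : ℝ) (q : Euc d ⧸ L) (v : Euc d)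
      (hy : Reaches D y t (WithLp.toLp 2 (q, v)))
      (σ τ : ℝ) (hσ : 0 < σ) (hτ : 0 < τ) (q₁ : Euc d ⧸ L) (v₁ ν : Euc d)
      (hin : ∀ s ∈ Ico 0 σ, shift q (s • v) ∈ D)
      (hq₁ : q₁ = shift q (σ • v))
      (hν : IsInnerNormal D q₁ ν) (hv : ⟪v, ν⟫ < 0)
      (hv₁ : v₁ = v - (2 * ⟪v, ν⟫) • ν)
      (hout : ∀ s ∈ Ioc 0 τ, shift q₁ (s • v₁) ∈ D) :
      Reaches D y (t + σ + τ) (WithLp.toLp 2 (shift q₁ (τ • v₁), v₁))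

/-- The billiard flow, for positive and negative times, takes `y` to `y'` in time `t`. -/
def FlowsTo (D : Set (Euc d ⧸ L)) (t : ℝ) (y y' : Phase L) : Prop :=
  (0 ≤ t ∧ Reaches D y t y') ∨ (t < 0 ∧ Reaches D y' (-t) y)

/-- The domain of definition of `Φ^t`: the points of `Ω` whose orbit between the times `0` and
`t` is regular and which are not at a reflection at time `t`. -/
def flowDomain (D : Set (Euc d ⧸ L)) (t : ℝ) : Set (Phase L) :=
  {y | y ∈ phaseSpace D ∧ ∃ y', FlowsTo D t y y'}

open Classical in
/-- The billiard flow `Φ^t`, meaningful on `flowDomain D t`. -/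
noncomputable def flow (D : Set (Euc d ⧸ L)) (t : ℝ) (y : Phase L) : Phase L :=
  if h : ∃ y', FlowsTo D t y y' then h.choose else y

/-- The image `Φ^t (J)`. -/
def flowImage (D : Set (Euc d ⧸ L)) (t : ℝ) (J : Set (Phase L)) : Set (Phase L) :=
  flow D t '' (J ∩ flowDomain D t)

/-! ### Derivatives and hypersurfaces in the unit tangent bundle -/

/-- The map `F`, restricted to the unit tangent bundle, takes `y` to `y'` and is differentiable at
`y` with derivative `D_y F = A`. In flat coordinates around `y` and `y'`, `F` is given by `G`. -/
def HasTangentMapAt (F : Phase L → Phase L) (y y' : Phase L)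
    (A : tangentSpace y →ₗ[ℝ] tangentSpace y') : Prop :=
  ∃ (G : Vec d → Vec d) (G' : Vec d →L[ℝ] Vec d), G 0 = 0 ∧
    (∀ᶠ p in 𝓝[unitDisplacements y] 0, F (y.shift p) = y'.shift (G p)) ∧
    HasFDerivWithinAt G G' (unitDisplacements y) 0 ∧
    ∀ ξ : tangentSpace y, (A ξ : Vec d) = G' ξ

/-- Near its point `y`, the set `J` is a `C¹` embedded hypersurface (without boundary) of the unit
tangent bundle, with tangent space `T_y J = T`: in flat coordinates around `y` it is the zero set
of a `C¹` function `h` with `dh ≠ 0` on `T_y Ω`, and `T` is the kernel of `dh` on `T_y Ω`. -/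
def IsHypersurfaceAt (J : Set (Phase L)) (y : Phase L) (T : Submodule ℝ (tangentSpace y)) : Prop :=
  ∃ h : Vec d → ℝ, ContDiffAt ℝ 1 h 0 ∧ h 0 = 0 ∧
    (∀ᶠ p in 𝓝[unitDisplacements y] 0, (y.shift p ∈ J ↔ h p = 0)) ∧
    (∃ ξ : tangentSpace y, fderiv ℝ h 0 (ξ : Vec d) ≠ 0) ∧
    ∀ ξ : tangentSpace y, ξ ∈ T ↔ fderiv ℝ h 0 (ξ : Vec d) = 0

/-- `n ∈ T_y Ω` is a non-zero normal vector to the hypersurface with tangent space `T` at `y`. -/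
def IsNormalVector {y : Phase L} (T : Submodule ℝ (tangentSpace y)) (n : tangentSpace y) : Prop :=
  n ≠ 0 ∧ ∀ ξ : tangentSpace y, ξ ∈ T ↔ ⟪ξ, n⟫ = 0

/-! ### Hypersurface volume -/

/-- The `(2d-2)`-dimensional (Hausdorff) volume of subsets of the phase space. -/
noncomputable def hypersurfaceVolume [DiscreteTopology L] (A : Set (Phase L)) : ℝ≥0∞ :=
  μH[2 * (d : ℝ) - 2] A

/-- The map `F` expands the volume of the hypersurface `J` at its point `y` by the factor `c`:
each neighbourhood of `y` in `J` has positive volume, and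
`vol (F A) / vol A → c` as the set `A ⊆ J` of non-zero volume shrinks to `y`. -/
def ExpandsVolumeAt [DiscreteTopology L] (F : Phase L → Phase L) (J : Set (Phase L))
    (y : Phase L) (c : ℝ) : Prop :=
  (∀ r > 0, hypersurfaceVolume (J ∩ Metric.ball y r) ≠ 0) ∧
    Tendsto (fun A : Set (Phase L) => hypersurfaceVolume (F '' A) / hypersurfaceVolume A)
      ((𝓝[J] y).smallSets ⊓ 𝓟 {A | hypersurfaceVolume A ≠ 0}) (𝓝 (ENNReal.ofReal c))

end Basic

end Billiard

/-! In flat coordinates around `y₀` and `yt` the flow is a `C¹` local diffeomorphism `G` of the full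
space of displacements, defined also for speeds other than `1`. Its derivative has determinant `±1`:
free flight is a shear, and each collision is, to first order, block triangular with the reflection
in the tangent plane in both diagonal blocks (`abs_det_fderiv_collisionMap`). Transversality of the
collisions gives a `C¹` hitting time by the implicit function theorem. Nearby orbits have the same
collision pattern because the free pieces stay in the open set `D`, uniformly up to the boundary
(`eventually_ray_mem`). The inverse of `G` comes from the flow with reversed velocity, and
determinism of the flow shows that the two are inverse to each other (`Reaches.exists_isFlowChart`).

The volume factor rests on one fact of linear algebra, `hausdorffMeasure_image_hyperplane`: if `A`
scales volume by `c` and `⟪A x, w⟫ = ⟪x, n⟫`, then `A` scales volume in the hyperplane orthogonal to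
`n` by `c ‖w‖ / ‖n‖`. It is used twice. With `n = (0, v)` and `w = (0, v')` the relation is
conservation of speed, and as both vectors have the same norm the derivative preserves volume on the
tangent space of the phase space. With `n₀` and `nt`, inside that tangent space, it gives the factor
`‖nt‖ / ‖n₀‖` on the tangent space of `J`.

To pass from the derivative to the flow, `J` is written as a regular level set of a map to the
plane. Near the base point, the projection of `J` to its tangent space is bi-Lipschitz with
constants close to `1`, and so is the comparison of `G` on `J` with its derivative after that
projection (`eventually_dist_le`). Lipschitz bounds for Hausdorff measure apply to arbitrary sets,
so no measurability of `A` is needed. -/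

namespace Billiard

/-! ### Determinism, composition and time reversal of the billiard motion. -/

section Dynamics

variable {d : ℕ} {L : AddSubgroup (Euc d)} {D : Set (Euc d ⧸ L)}

lemma shift_zero (q : Euc d ⧸ L) : shift q 0 = q := by
  simp [shift]

lemma shift_shift (q : Euc d ⧸ L) (x y : Euc d) : shift (shift q x) y = shift q (x + y) := by
  simp [shift, add_assoc]

lemma IsInnerNormal.notMem {q : Euc d ⧸ L} {ν : Euc d} (h : IsInnerNormal D q ν) : q ∉ D := by
  obtain ⟨f, -, h0, -, -, h⟩ := h
  simpa [shift_zero] using h.self_of_nhds.2 h0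

lemma IsInnerNormal.norm_eq_one {q : Euc d ⧸ L} {ν : Euc d} (h : IsInnerNormal D q ν) :
    ‖ν‖ = 1 := by
  obtain ⟨f, -, -, h1, rfl, -⟩ := h
  rw [norm_smul, norm_inv, norm_norm, inv_mul_cancel₀ (norm_ne_zero_iff.2 h1)]

/-- If `f` has no positive values on `{g = 0}` near a common zero of `f` and `g`, then `∇f` and
`∇g` are parallel there. -/
lemma exists_smul_of_nonpos_on_zeros {E : Type*} [NormedAddCommGroup E] [NormedSpace ℝ E]
    [CompleteSpace E] {f g : E → ℝ} {f' g' : E →L[ℝ] ℝ} {x : E}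
    (hf : HasStrictFDerivAt f f' x) (hg : HasStrictFDerivAt g g' x) (hfx : f x = 0) (hgx : g x = 0)
    (hg' : g' ≠ 0) (h : ∀ᶠ y in 𝓝 x, g y = 0 → f y ≤ 0) : ∃ c : ℝ, f' = c • g' := by
  obtain ⟨u, hu⟩ : ∃ u, g' u ≠ 0 := by
    by_contra! h0
    exact hg' (by ext u; simpa using h0 u)
  by_contra! hc
  obtain ⟨w, hw0, hw⟩ : ∃ w, g' w = 0 ∧ f' w ≠ 0 := by
    by_contra! h0
    refine hc (f' u / g' u) ?_
    ext z
    have := h0 (z - (g' z / g' u) • u) (by simp [hu])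
    simp only [map_sub, map_smul, smul_eq_mul] at this
    rw [smul_apply, smul_eq_mul, sub_eq_zero.1 this]
    ring
  -- If the derivatives were not parallel, `(f, g)` would be a submersion at `x`, hence open there,
  -- and would attain values `(s, 0)` with `s > 0` arbitrarily close to `x`.
  have hsurj : (f'.prod g').range = ⊤ := by
    rw [LinearMap.range_eq_top]
    rintro ⟨a, b⟩
    refine ⟨(b / g' u) • u + ((a - b / g' u * f' u) / f' w) • w, ?_⟩
    simp only [ContinuousLinearMap.coe_coe, ContinuousLinearMap.prod_apply, map_add, map_smul,
      hw0, Prod.smul_mk, Prod.mk_add_mk, smul_eq_mul, Prod.mk.injEq]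
    constructor <;> field_simp <;> ring
  have hmap := (hf.prodMk hg).map_nhds_eq_of_surj hsurj
  have : {z : ℝ × ℝ | z.2 = 0 → z.1 ≤ 0} ∈ 𝓝 ((0 : ℝ), (0 : ℝ)) := by
    rw [hfx, hgx] at hmap
    rw [← hmap]
    exact h
  have hlim : Tendsto (fun s : ℝ => (s, (0 : ℝ))) (𝓝[>] 0) (𝓝 ((0 : ℝ), (0 : ℝ))) := by
    have : Continuous fun s : ℝ => (s, (0 : ℝ)) := by fun_prop
    exact (this.tendsto 0).mono_left nhdsWithin_le_nhds
  obtain ⟨s, hs1, hs2⟩ := ((hlim.eventually this).and self_mem_nhdsWithin).exists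
  exact absurd (hs1 rfl) (not_le.2 hs2)

/-- The zero set of `g` misses `D` while `{f > 0}` lies in `D`, so `f ≤ 0` on `{g = 0}` and the
gradients are parallel. This leaves `ν = ±ν'`, as when `D` lies on both sides of the hypersurface;
the incoming velocity selects the sign. -/
lemma IsInnerNormal.unique {q : Euc d ⧸ L} {v ν ν' : Euc d} (h : IsInnerNormal D q ν)
    (h' : IsInnerNormal D q ν') (hv : ⟪v, ν⟫ < 0) (hv' : ⟪v, ν'⟫ < 0) : ν = ν' := by
  have h1 := h.norm_eq_one
  have h1' := h'.norm_eq_one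
  obtain ⟨f, hf, hf0, hf', hν, hfD⟩ := h
  obtain ⟨g, hg, hg0, hg', hν', hgD⟩ := h'
  have hgrad : ∀ {u : Euc d → ℝ}, ContDiffAt ℝ 3 u 0 →
      HasStrictFDerivAt u (innerSL ℝ (gradient u 0)) 0 := by
    intro u hu
    have h1 := (hu.differentiableAt (by norm_num)).hasGradientAt.hasFDerivAt
    have h2 := hu.hasStrictFDerivAt (by norm_num)
    rw [h1.fderiv] at h2
    exact h2
  obtain ⟨c, hc⟩ := exists_smul_of_nonpos_on_zeros (hgrad hf) (hgrad hg) hf0 hg0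
    (fun h0 => hg' (by
      have := congrArg (fun k => k (gradient g 0)) h0
      simpa using this))
    (by
      filter_upwards [hfD, hgD] with y hy1 hy2 hgy
      by_contra! hlt
      exact hy2.2 hgy (hy1.1 hlt))
  have hpar : gradient f 0 = c • gradient g 0 := by
    refine ext_inner_right ℝ fun z => ?_
    have := congrArg (fun k => k z) hc
    simpa [inner_smul_left] using this
  obtain ⟨k, hk⟩ : ∃ k : ℝ, ν = k • ν' := by
    refine ⟨‖gradient f 0‖⁻¹ * c * ‖gradient g 0‖, ?_⟩
    rw [hν, hpar, hν', smul_smul, smul_smul, mul_assoc (‖c • gradient g 0‖⁻¹ * c),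
      mul_inv_cancel₀ (norm_ne_zero_iff.2 hg'), mul_one]
  have hkabs : |k| = 1 := by
    rw [hk, norm_smul, h1', mul_one] at h1
    simpa using h1
  have hkpos : 0 < k := by
    rw [hk, inner_smul_right] at hv
    nlinarith
  rw [hk, ← abs_of_pos hkpos, hkabs, one_smul]

/-- `Leaves D q v t q' v'`: a particle that starts at `q` with velocity `v`, where `q` may be the
position of a collision that has just taken place, is at `q'` with velocity `v'` after time `t`. -/
inductive Leaves (D : Set (Euc d ⧸ L)) : Euc d ⧸ L → Euc d → ℝ → Euc d ⧸ L → Euc d → Prop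
  | free (q : Euc d ⧸ L) (v : Euc d) (t : ℝ) (ht : 0 ≤ t)
      (hfree : ∀ s ∈ Ioc 0 t, shift q (s • v) ∈ D) (q' : Euc d ⧸ L) (hq' : q' = shift q (t • v)) :
      Leaves D q v t q' v
  | collide (q : Euc d ⧸ L) (v : Euc d) (σ t : ℝ) (hσ : 0 < σ) (ht : 0 < t)
      (hin : ∀ s ∈ Ioo 0 σ, shift q (s • v) ∈ D) (q₁ : Euc d ⧸ L) (v₁ ν : Euc d)
      (hq₁ : q₁ = shift q (σ • v)) (hν : IsInnerNormal D q₁ ν) (hv : ⟪v, ν⟫ < 0)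
      (hv₁ : v₁ = v - (2 * ⟪v, ν⟫) • ν) (q' : Euc d ⧸ L) (v' : Euc d)
      (hl : Leaves D q₁ v₁ t q' v') (t' : ℝ) (ht' : t' = σ + t) :
      Leaves D q v t' q' v'

lemma Leaves.nonneg {q q' : Euc d ⧸ L} {v v' : Euc d} {t : ℝ} (h : Leaves D q v t q' v') :
    0 ≤ t := by
  cases h with
  | free _ _ _ ht => exact ht
  | collide _ _ σ t hσ ht => linarith

/-- `Reaches` peels off the last collision, `Leaves` the first, and determinism needs the first: the
collision point is outside `D` and all earlier points of the ray are inside, so the first collision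
times agree; then the normals agree by `IsInnerNormal.unique`. -/
lemma Leaves.unique {q q' q'' : Euc d ⧸ L} {v v' v'' : Euc d} {t : ℝ} (h : Leaves D q v t q' v')
    (h2 : Leaves D q v t q'' v'') : q' = q'' ∧ v' = v'' := by
  induction h generalizing q'' v'' with
  | free q v t ht hfree q' hq' =>
    cases h2 with
    | free _ _ _ _ hfree2 _ hq2 => exact ⟨hq'.trans hq2.symm, rfl⟩
    | collide _ _ σ t2 hσ ht2 _ q₁ _ _ hq₁ hν _ _ _ _ _ _ ht' =>
      exact absurd (hq₁ ▸ hfree σ ⟨hσ, by linarith⟩) hν.notMem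
  | collide q v σ t hσ ht hin q₁ v₁ ν hq₁ hν hv hv₁ q' v' hl t' ht' ih =>
    cases h2 with
    | free _ _ _ _ hfree2 _ hq2 =>
      exact absurd (hq₁ ▸ hfree2 σ ⟨hσ, by linarith⟩) hν.notMem
    | collide _ _ σ2 t2 hσ2 ht2 hin2 q₂ v₂ ν₂ hq₂ hν₂ hv₂ hv₂' _ _ hl2 _ ht2' =>
      have hσσ : σ = σ2 := by
        rcases lt_trichotomy σ σ2 with h | h | h
        · exact absurd (hq₁ ▸ hin2 σ ⟨hσ, h⟩) hν.notMem
        · exact h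
        · exact absurd (hq₂ ▸ hin σ2 ⟨hσ2, h⟩) hν₂.notMem
      subst hσσ
      have hqq : q₂ = q₁ := hq₂.trans hq₁.symm
      subst hqq
      have hνν : ν = ν₂ := hν.unique hν₂ hv hv₂
      subst hνν
      have hvv : v₂ = v₁ := hv₂'.trans hv₁.symm
      subst hvv
      have htt : t = t2 := by linarith
      subst htt
      exact ih hl2

lemma Leaves.trans {q q' q'' : Euc d ⧸ L} {v v' v'' : Euc d} {s t : ℝ} (h : Leaves D q v s q' v')
    (h2 : Leaves D q' v' t q'' v'') : Leaves D q v (s + t) q'' v'' := by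
  induction h generalizing q'' v'' with
  | free q v s hs hfree q' hq' =>
    have key : ∀ r : ℝ, shift q' (r • v) = shift q ((s + r) • v) := by
      intro r
      rw [hq', shift_shift, add_smul]
    cases h2 with
    | free _ _ _ ht hfree2 _ hq2 =>
      refine .free _ _ _ (by linarith) (fun r hr => ?_) _ (by rw [hq2, key])
      rcases le_or_gt r s with h | h
      · exact hfree r ⟨hr.1, h⟩
      · have := hfree2 (r - s) ⟨by linarith, by linarith [hr.2]⟩
        rwa [key, add_sub_cancel] at this
    | collide _ _ σ t2 hσ ht2 hin q₁ v₁ ν hq₁ hν hv hv₁ _ _ hl _ ht' =>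
      refine .collide q v (s + σ) t2 (by linarith) ht2 (fun r hr => ?_) q₁ v₁ ν
        (by rw [hq₁, key]) hν hv hv₁ _ _ hl _ (by rw [ht']; ring)
      rcases le_or_gt r s with h | h
      · exact hfree r ⟨hr.1, h⟩
      · have := hin (r - s) ⟨by linarith, by linarith [hr.2]⟩
        rwa [key, add_sub_cancel] at this
  | collide q v σ t1 hσ ht hin q₁ v₁ ν hq₁ hν hv hv₁ q' v' hl t' ht' ih =>
    exact .collide q v σ (t1 + t) hσ (by linarith [h2.nonneg]) hin q₁ v₁ ν hq₁ hν hv hv₁ _ _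
      (ih h2) _ (by rw [ht']; ring)

lemma Reaches.leaves {y y' : Phase L} {t : ℝ} (h : Reaches D y t y') :
    Leaves D y.fst y.snd t y'.fst y'.snd := by
  induction h with
  | free q v t ht hfree => exact .free _ _ _ ht (fun s hs => hfree s ⟨hs.1.le, hs.2⟩) _ rfl
  | collide y t q v hy σ τ hσ hτ q₁ v₁ ν hin hq₁ hν hv hv₁ hout ih =>
    rw [add_assoc]
    exact ih.trans (.collide q v σ τ hσ hτ (fun s hs => hin s ⟨hs.1.le, hs.2⟩) q₁ v₁ ν hq₁ hν hv hv₁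
      _ _ (.free _ _ _ hτ.le hout _ rfl) _ rfl)

lemma phase_ext {y y' : Phase L} (h1 : y.fst = y'.fst) (h2 : y.snd = y'.snd) : y = y' :=
  WithLp.ofLp_injective 2 (Prod.ext h1 h2)

lemma Reaches.unique {y y' y'' : Phase L} {t : ℝ} (h : Reaches D y t y')
    (h2 : Reaches D y t y'') : y' = y'' :=
  phase_ext (h.leaves.unique h2.leaves).1 (h.leaves.unique h2.leaves).2

lemma Reaches.nonneg {y y' : Phase L} {t : ℝ} (h : Reaches D y t y') : 0 ≤ t :=
  h.leaves.nonneg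

lemma Reaches.fst_mem_right {y y' : Phase L} {t : ℝ} (h : Reaches D y t y') : y'.fst ∈ D := by
  cases h with
  | free q v t ht hfree => exact hfree t ⟨ht, le_rfl⟩
  | collide y t q v hy σ τ hσ hτ q₁ v₁ ν hin hq₁ hν hv hv₁ hout => exact hout τ ⟨hτ, le_rfl⟩

lemma Reaches.fst_mem_left {y y' : Phase L} {t : ℝ} (h : Reaches D y t y') : y.fst ∈ D := by
  induction h with
  | free q v t ht hfree => simpa [shift_zero] using hfree 0 ⟨le_rfl, ht⟩
  | collide y t q v hy σ τ hσ hτ q₁ v₁ ν hin hq₁ hν hv hv₁ hout ih => exact ih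

lemma reaches_zero {y : Phase L} (hy : y.fst ∈ D) : Reaches D y 0 y := by
  have := Reaches.free (D := D) y.fst y.snd 0 le_rfl (fun s hs => by
    obtain rfl : s = 0 := le_antisymm hs.2 hs.1
    simpa [shift_zero] using hy)
  rwa [zero_smul, shift_zero] at this

lemma Reaches.eq_of_zero {y y' : Phase L} (h : Reaches D y 0 y') : y = y' :=
  (reaches_zero h.fst_mem_left).unique h

/-- No constructor of `Reaches` appends a free flight, so the new flight is merged with the last
one. -/
lemma Reaches.extend {y y' : Phase L} {s t : ℝ} (h : Reaches D y s y') (ht : 0 ≤ t)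
    (hfree : ∀ r ∈ Icc 0 t, shift y'.fst (r • y'.snd) ∈ D) :
    Reaches D y (s + t) (WithLp.toLp 2 (shift y'.fst (t • y'.snd), y'.snd)) := by
  cases h with
  | free q v s hs hfree1 =>
    change ∀ r ∈ Icc 0 t, shift (shift q (s • v)) (r • v) ∈ D at hfree
    change Reaches D _ _ (WithLp.toLp 2 (shift (shift q (s • v)) (t • v), v))
    rw [shift_shift, ← add_smul]
    refine .free q v _ (by linarith) fun r hr => ?_
    rcases le_or_gt r s with h | h
    · exact hfree1 r ⟨hr.1, h⟩
    · have := hfree (r - s) ⟨by linarith, by linarith [hr.2]⟩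
      rwa [shift_shift, ← add_smul, add_sub_cancel] at this
  | collide y s q v hy σ τ hσ hτ q₁ v₁ ν hin hq₁ hν hv hv₁ hout =>
    change ∀ r ∈ Icc 0 t, shift (shift q₁ (τ • v₁)) (r • v₁) ∈ D at hfree
    change Reaches D _ _ (WithLp.toLp 2 (shift (shift q₁ (τ • v₁)) (t • v₁), v₁))
    rw [shift_shift, ← add_smul, add_assoc]
    refine .collide y s q v hy σ (τ + t) hσ (by linarith) q₁ v₁ ν hin hq₁ hν hv hv₁ fun r hr => ?_
    rcases le_or_gt r τ with h | h
    · exact hout r ⟨hr.1, h⟩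
    · have := hfree (r - τ) ⟨by linarith, by linarith [hr.2]⟩
      rwa [shift_shift, ← add_smul, add_sub_cancel] at this

lemma Reaches.trans {y y' y'' : Phase L} {s t : ℝ} (h : Reaches D y s y')
    (h2 : Reaches D y' t y'') : Reaches D y (s + t) y'' := by
  induction h2 with
  | free q v t ht hfree => exact h.extend ht hfree
  | collide y' t q v hy σ τ hσ hτ q₁ v₁ ν hin hq₁ hν hv hv₁ hout ih =>
    have := Reaches.collide y (s + t) q v (ih h) σ τ hσ hτ q₁ v₁ ν hin hq₁ hν hv hv₁ hout
    rwa [show s + (t + σ + τ) = s + t + σ + τ by ring]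

/-- Reversal of the velocity. -/
def reversal (y : Phase L) : Phase L := WithLp.toLp 2 (y.fst, -y.snd)

lemma reversal_reversal (y : Phase L) : reversal (reversal y) = y :=
  phase_ext rfl (neg_neg _)

/-- A reflection negates the normal component, `⟪v₁, ν⟫ = -⟪v, ν⟫`, so `-v₁` is again incoming for
the same normal and is reflected to `-v`. -/
lemma Reaches.reverse {y y' : Phase L} {t : ℝ} (h : Reaches D y t y') :
    Reaches D (reversal y') t (reversal y) := by
  induction h with
  | free q v t ht hfree =>
    have key : ∀ r : ℝ, shift (shift q (t • v)) (r • (-v)) = shift q ((t - r) • v) := by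
      intro r
      rw [shift_shift, smul_neg, sub_smul, sub_eq_add_neg]
    have := Reaches.free (D := D) (shift q (t • v)) (-v) t ht (fun s hs => by
      rw [key]
      exact hfree _ ⟨by linarith [hs.2], by linarith [hs.1]⟩)
    rwa [key, sub_self, zero_smul, shift_zero] at this
  | collide y t q v hy σ τ hσ hτ q₁ v₁ ν hin hq₁ hν hv hv₁ hout ih =>
    have hν1 : ⟪ν, ν⟫ = (1 : ℝ) := by rw [real_inner_self_eq_norm_sq, hν.norm_eq_one, one_pow]
    have hvν : ⟪v₁, ν⟫ = -⟪v, ν⟫ := by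
      rw [hv₁, inner_sub_left, inner_smul_left, hν1]
      simp only [conj_trivial]
      ring
    have key : ∀ r : ℝ, shift (shift q₁ (τ • v₁)) (r • (-v₁)) = shift q₁ ((τ - r) • v₁) := by
      intro r
      rw [shift_shift, smul_neg, sub_smul, sub_eq_add_neg]
    have key2 : ∀ r : ℝ, shift q₁ (r • (-v)) = shift q ((σ - r) • v) := by
      intro r
      rw [hq₁, shift_shift, smul_neg, sub_smul, sub_eq_add_neg]
    have h0 : Reaches D (reversal (WithLp.toLp 2 (shift q₁ (τ • v₁), v₁))) 0
        (WithLp.toLp 2 (shift q₁ (τ • v₁), -v₁)) :=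
      reaches_zero (hout τ ⟨hτ, le_rfl⟩)
    have h1 := Reaches.collide _ 0 _ _ h0 τ σ hτ hσ q₁ (-v) ν
      (fun s hs => by
        rw [key]
        exact hout _ ⟨by linarith [hs.2], by linarith [hs.1]⟩)
      (by rw [key, sub_self, zero_smul, shift_zero]) hν
      (by rwa [inner_neg_left, hvν, neg_neg])
      (by
        rw [inner_neg_left, hvν, neg_neg, hv₁]
        module)
      (fun s hs => by
        rw [key2]
        exact hin _ ⟨by linarith [hs.2], by linarith [hs.1]⟩)
    rw [key2, sub_self, zero_smul, shift_zero] at h1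
    have := h1.trans ih
    rwa [show 0 + τ + σ + t = t + σ + τ by ring] at this

lemma Reaches.norm_snd {y y' : Phase L} {t : ℝ} (h : Reaches D y t y') : ‖y'.snd‖ = ‖y.snd‖ := by
  induction h with
  | free => rfl
  | collide y t q v hy σ τ hσ hτ q₁ v₁ ν hin hq₁ hν hv hv₁ hout ih =>
    rw [← ih]
    change ‖v₁‖ = ‖v‖
    have hν1 := hν.norm_eq_one
    rw [← sq_eq_sq₀ (norm_nonneg _) (norm_nonneg _), hv₁, norm_sub_sq_real, norm_smul, hν1,
      inner_smul_right, mul_one, Real.norm_eq_abs, sq_abs]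
    ring

lemma FlowsTo.symm {y y' : Phase L} {t : ℝ} (h : FlowsTo D t y y') : FlowsTo D (-t) y' y := by
  rcases h with ⟨ht, h⟩ | ⟨ht, h⟩
  · rcases ht.eq_or_lt with rfl | ht
    · obtain rfl := h.eq_of_zero
      exact Or.inl ⟨by simp, by simpa using h⟩
    · exact Or.inr ⟨by linarith, by simpa using h⟩
  · exact Or.inl ⟨by linarith, h⟩

lemma FlowsTo.unique {y y' y'' : Phase L} {t : ℝ} (h : FlowsTo D t y y')
    (h2 : FlowsTo D t y y'') : y' = y'' := by
  rcases h with ⟨ht, h⟩ | ⟨ht, h⟩ <;> rcases h2 with ⟨ht2, h2⟩ | ⟨ht2, h2⟩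
  · exact h.unique h2
  · linarith
  · linarith
  -- Uniqueness of the past is uniqueness of the future after reversing velocities.
  · have := h.reverse.unique h2.reverse
    rw [← reversal_reversal y', this, reversal_reversal]

lemma FlowsTo.norm_snd {y y' : Phase L} {t : ℝ} (h : FlowsTo D t y y') : ‖y'.snd‖ = ‖y.snd‖ := by
  rcases h with ⟨-, h⟩ | ⟨-, h⟩
  exacts [h.norm_snd, h.norm_snd.symm]

lemma FlowsTo.fst_mem_left {y y' : Phase L} {t : ℝ} (h : FlowsTo D t y y') : y.fst ∈ D := by
  rcases h with ⟨-, h⟩ | ⟨-, h⟩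
  exacts [h.fst_mem_left, h.fst_mem_right]

lemma FlowsTo.flow_eq {y y' : Phase L} {t : ℝ} (h : FlowsTo D t y y') : flow D t y = y' := by
  have hex : ∃ y', FlowsTo D t y y' := ⟨y', h⟩
  rw [flow, dif_pos hex]
  exact hex.choose_spec.unique h

lemma flowsTo_flow {y : Phase L} {t : ℝ} (h : y ∈ flowDomain D t) : FlowsTo D t y (flow D t y) := by
  rw [flow, dif_pos h.2]
  exact h.2.choose_spec

end Dynamics

/-- `HasFDerivAt.fderiv` for normed spaces; the general version is slow to unify for `Vec d`. -/
lemma fderiv_eq_of_hasFDerivAt {E F : Type*} [NormedAddCommGroup E] [NormedSpace ℝ E]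
    [NormedAddCommGroup F] [NormedSpace ℝ F] {G : E → F} {G' : E →L[ℝ] F} {x : E}
    (h : HasFDerivAt G G' x) : fderiv ℝ G x = G' :=
  h.fderiv

lemma hasDerivAt_smul_line {E : Type*} [NormedAddCommGroup E] [NormedSpace ℝ E] (p : E) :
    HasDerivAt (fun u : ℝ => u • p) p 0 := by
  simpa using (hasDerivAt_id (0 : ℝ)).smul_const p

lemma hasDerivAt_along_line {E F : Type*} [NormedAddCommGroup E] [NormedSpace ℝ E]
    [NormedAddCommGroup F] [NormedSpace ℝ F] {G : E → F} (hG : ContDiffAt ℝ 1 G 0) (p : E) :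
    HasDerivAt (fun u : ℝ => G (u • p)) (fderiv ℝ G 0 p) 0 := by
  refine HasFDerivAt.comp_hasDerivAt (0 : ℝ) ?_ (hasDerivAt_smul_line p)
  simpa using (hG.differentiableAt (by norm_num)).hasFDerivAt

lemma tendsto_smul_line {E : Type*} [NormedAddCommGroup E] [NormedSpace ℝ E] (p : E) :
    Tendsto (fun u : ℝ => u • p) (𝓝 0) (𝓝 0) := by
  simpa using (hasDerivAt_smul_line p).continuousAt.tendsto

/-! ### Determinants of shears and of block triangular maps; smoothness of components. -/

section LinearAlgebra

/-- The characteristic polynomial of the nilpotent map `-N` is a power of `X`; its value at `1` is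
the determinant. -/
lemma det_one_add_of_comp_self_eq_zero {V : Type*} [AddCommGroup V] [Module ℝ V]
    [FiniteDimensional ℝ V] (N : V →ₗ[ℝ] V) (hN : N ∘ₗ N = 0) : LinearMap.det (1 + N) = 1 := by
  have hnil : IsNilpotent (-N) := ⟨2, by rw [pow_two, neg_mul_neg]; exact hN⟩
  have h := (LinearMap.charpoly_eq_X_pow_iff (-N)).2 fun m => by
    obtain ⟨k, hk⟩ := hnil
    exact ⟨k, by rw [hk]; rfl⟩
  have h2 := LinearMap.eval_charpoly (-N) 1
  rw [h] at h2
  simpa [sub_neg_eq_add] using h2.symm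

variable {d : ℕ}

/-- With the involution `Q = R × R`, the map `K ∘ Q - 1` takes values in `{δq = 0}` and vanishes
there, so it squares to zero and `det K * det Q = 1`, where `det Q = ±1`. The lower left block of
`K`, which carries the curvature of the boundary, never enters. -/
lemma abs_det_eq_one_of_block (K : Vec d →ₗ[ℝ] Vec d) (R : Euc d →ₗ[ℝ] Euc d)
    (hR : ∀ a, R (R a) = a) (h1 : ∀ p, (K p).fst = R p.fst)
    (h2 : ∀ b, (K (WithLp.toLp 2 (0, b))).snd = R b) : |LinearMap.det K| = 1 := by
  let Q : Vec d →ₗ[ℝ] Vec d :=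
    { toFun := fun p => WithLp.toLp 2 (R p.fst, R p.snd)
      map_add' := fun p p' => by
        rw [WithLp.add_fst, WithLp.add_snd, map_add, map_add, ← Prod.mk_add_mk, WithLp.toLp_add]
      map_smul' := fun c p => by
        rw [WithLp.smul_fst, WithLp.smul_snd, map_smul, map_smul, ← Prod.smul_mk,
          WithLp.toLp_smul, RingHom.id_apply] }
  have hQQ : Q ∘ₗ Q = LinearMap.id := by
    ext1 p
    change WithLp.toLp 2 (R (R p.fst), R (R p.snd)) = p
    rw [hR, hR]
    rfl
  have hdQ : LinearMap.det Q * LinearMap.det Q = 1 := by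
    rw [← LinearMap.det_comp, hQQ, LinearMap.det_id]
  set N : Vec d →ₗ[ℝ] Vec d := K ∘ₗ Q - 1 with hN
  have hN1 : ∀ p, (N p).fst = 0 := by
    intro p
    have : (N p).fst = (K (Q p)).fst - p.fst := rfl
    rw [this, h1]
    change R (R p.fst) - p.fst = 0
    rw [hR, sub_self]
  have hN2 : ∀ p : Vec d, p.fst = 0 → N p = 0 := by
    intro p hp
    have h3 : (N p).snd = (K (Q p)).snd - p.snd := rfl
    have h4 : Q p = WithLp.toLp 2 (0, R p.snd) := by
      change WithLp.toLp 2 (R p.fst, R p.snd) = _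
      rw [hp, map_zero]
    rw [h4, h2, hR, sub_self] at h3
    exact WithLp.ofLp_injective 2 (Prod.ext (hN1 p) h3)
  have hNN : N ∘ₗ N = 0 := by
    ext1 p
    exact hN2 _ (hN1 p)
  have hdet := det_one_add_of_comp_self_eq_zero N hNN
  rw [hN, add_sub_cancel, LinearMap.det_comp] at hdet
  have h5 := congrArg abs hdet
  have h6 := congrArg abs hdQ
  rw [abs_mul, abs_one] at h5 h6
  have h7 : |LinearMap.det Q| = 1 := by nlinarith [abs_nonneg (LinearMap.det Q)]
  rwa [h7, mul_one] at h5

section Components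

variable {X : Type*} [NormedAddCommGroup X] [NormedSpace ℝ X] {n : WithTop ℕ∞} {g : X → Vec d}
  {x : X}

@[fun_prop]
lemma contDiff_vec_fst (hg : ContDiff ℝ n g) : ContDiff ℝ n fun x => (g x).fst :=
  (WithLp.fstL 2 ℝ (Euc d) (Euc d)).contDiff.comp hg

@[fun_prop]
lemma contDiff_vec_snd (hg : ContDiff ℝ n g) : ContDiff ℝ n fun x => (g x).snd :=
  (WithLp.sndL 2 ℝ (Euc d) (Euc d)).contDiff.comp hg

@[fun_prop]
lemma contDiffAt_vec_fst (hg : ContDiffAt ℝ n g x) : ContDiffAt ℝ n (fun x => (g x).fst) x :=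
  (WithLp.fstL 2 ℝ (Euc d) (Euc d)).contDiff.contDiffAt.comp x hg

@[fun_prop]
lemma contDiffAt_vec_snd (hg : ContDiffAt ℝ n g x) : ContDiffAt ℝ n (fun x => (g x).snd) x :=
  (WithLp.sndL 2 ℝ (Euc d) (Euc d)).contDiff.contDiffAt.comp x hg

@[fun_prop]
lemma contDiffAt_vec_mk {a b : X → Euc d} (ha : ContDiffAt ℝ n a x) (hb : ContDiffAt ℝ n b x) :
    ContDiffAt ℝ n (fun x => (WithLp.toLp 2 (a x, b x) : Vec d)) x :=
  (WithLp.prodContinuousLinearEquiv 2 ℝ (Euc d) (Euc d)).symm.contDiff.contDiffAt.comp x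
    (ha.prodMk hb)

lemma hasFDerivAt_vec_fst {g' : X →L[ℝ] Vec d} (hg : HasFDerivAt g g' x) :
    HasFDerivAt (fun x => (g x).fst) (WithLp.fstL 2 ℝ (Euc d) (Euc d) ∘L g') x :=
  (WithLp.fstL 2 ℝ (Euc d) (Euc d)).hasFDerivAt.comp x hg

lemma hasFDerivAt_vec_snd {g' : X →L[ℝ] Vec d} (hg : HasFDerivAt g g' x) :
    HasFDerivAt (fun x => (g x).snd) (WithLp.sndL 2 ℝ (Euc d) (Euc d) ∘L g') x :=
  (WithLp.sndL 2 ℝ (Euc d) (Euc d)).hasFDerivAt.comp x hg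

end Components

/-- The linear map `(δq, δv) ↦ (δq + t δv, δv)`, the free motion for the time `t` in flat
coordinates. -/
noncomputable def freeMotion (d : ℕ) (t : ℝ) : Vec d →L[ℝ] Vec d :=
  (WithLp.prodContinuousLinearEquiv 2 ℝ (Euc d) (Euc d)).symm.toContinuousLinearMap ∘L
    (WithLp.fstL 2 ℝ (Euc d) (Euc d) + t • WithLp.sndL 2 ℝ (Euc d) (Euc d)).prod
      (WithLp.sndL 2 ℝ (Euc d) (Euc d))

lemma det_freeMotion (t : ℝ) : LinearMap.det (freeMotion d t : Vec d →ₗ[ℝ] Vec d) = 1 := by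
  set N : Vec d →ₗ[ℝ] Vec d := (freeMotion d t : Vec d →ₗ[ℝ] Vec d) - 1 with hN
  have hN1 : ∀ p, N p = WithLp.toLp 2 (t • p.snd, 0) := by
    intro p
    refine WithLp.ofLp_injective 2 (Prod.ext ?_ ?_)
    · change p.fst + t • p.snd - p.fst = t • p.snd
      abel
    · change p.snd - p.snd = 0
      abel
  have := det_one_add_of_comp_self_eq_zero N (by
    ext1 p
    rw [LinearMap.comp_apply, hN1 (N p), hN1 p]
    change WithLp.toLp 2 (t • (0 : Euc d), 0) = 0
    rw [smul_zero]
    rfl)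
  rwa [hN, add_sub_cancel] at this

end LinearAlgebra

/-! ### Rays issuing from the boundary, the normal field and the hitting time. -/

section Boundary

variable {d : ℕ} {L : AddSubgroup (Euc d)} {D : Set (Euc d ⧸ L)}

lemma continuous_shift (q : Euc d ⧸ L) : Continuous (shift q) :=
  continuous_const.add continuous_quotient_mk'

/-- Strict differentiability makes the first order expansion uniform in the base point, so a single
neighbourhood serves all base points, small positive times and directions near `w`. -/
lemma eventually_lt_apply_add_smul {E : Type*} [NormedAddCommGroup E] [NormedSpace ℝ E]
    {f : E → ℝ} {f' : E →L[ℝ] ℝ} {w : E} (hf : HasStrictFDerivAt f f' 0) (hw : 0 < f' w) :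
    ∀ᶠ z : E × ℝ × E in 𝓝 (0, 0, w), 0 < z.2.1 → f z.1 < f (z.1 + z.2.1 • z.2.2) := by
  set ε : ℝ := f' w / (2 * (‖w‖ + 1)) with hε
  have hε0 : 0 < ε := by positivity
  have h1 : Tendsto (fun z : E × ℝ × E => (z.1 + z.2.1 • z.2.2, z.1)) (𝓝 (0, 0, w))
      (𝓝 ((0 : E), (0 : E))) := by
    have : Continuous fun z : E × ℝ × E => (z.1 + z.2.1 • z.2.2, z.1) := by fun_prop
    simpa using this.tendsto (0, 0, w)
  have h2 : ∀ᶠ z : E × ℝ × E in 𝓝 (0, 0, w), f' w / 2 < f' z.2.2 := by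
    have : Continuous fun z : E × ℝ × E => f' z.2.2 := by fun_prop
    exact this.continuousAt.eventually (lt_mem_nhds (show f' w / 2 < f' w by linarith))
  have h3 : ∀ᶠ z : E × ℝ × E in 𝓝 (0, 0, w), ‖z.2.2‖ < ‖w‖ + 1 := by
    have : Continuous fun z : E × ℝ × E => ‖z.2.2‖ := by fun_prop
    exact this.continuousAt.eventually (gt_mem_nhds (show ‖w‖ < ‖w‖ + 1 by linarith))
  filter_upwards [h1.eventually (hf.isLittleO.def hε0), h2, h3] with z hz1 hz2 hz3 hz
  simp only [add_sub_cancel_left, map_smul, smul_eq_mul, norm_smul, Real.norm_eq_abs,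
    abs_of_pos hz] at hz1
  have h4 := (abs_le.1 hz1).1
  have h5 : ε * (z.2.1 * ‖z.2.2‖) < z.2.1 * (f' w / 2) := by
    have : ε * ‖z.2.2‖ < f' w / 2 := by
      calc ε * ‖z.2.2‖ < ε * (‖w‖ + 1) := by gcongr
        _ = f' w / 2 := by rw [hε]; field_simp
    nlinarith
  nlinarith

lemma hasStrictFDerivAt_inner_gradient {E : Type*} [NormedAddCommGroup E] [InnerProductSpace ℝ E]
    [CompleteSpace E] {f : E → ℝ} {x : E} {n : WithTop ℕ∞} (hf : ContDiffAt ℝ n f x) (hn : n ≠ 0) :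
    HasStrictFDerivAt f (innerSL ℝ (gradient f x)) x := by
  have h1 := (hf.differentiableAt hn).hasGradientAt.hasFDerivAt
  have h2 := hf.hasStrictFDerivAt hn
  rw [h1.fderiv] at h2
  exact h2

/-- A ray that leaves a boundary point into `D` and stays in `D` for the time `T`
does so after small perturbations of its starting point on the boundary, velocity and time. -/
lemma eventually_ray_mem (hD : IsOpen D) {q : Euc d ⧸ L} {f : Euc d → ℝ} {f' : Euc d →L[ℝ] ℝ}
    (hf : HasStrictFDerivAt f f' 0) (hfD : ∀ᶠ z in 𝓝 (0 : Euc d), 0 < f z → shift q z ∈ D)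
    {X : Type*} [TopologicalSpace X] {p₀ : X} {x W : X → Euc d} {T : X → ℝ}
    (hx : ContinuousAt x p₀) (hW : ContinuousAt W p₀) (hT : ContinuousAt T p₀) (hx0 : x p₀ = 0)
    (hT0 : 0 < T p₀) (hfx : ∀ᶠ p in 𝓝 p₀, f (x p) = 0) (hfW : 0 < f' (W p₀))
    (hray : ∀ r ∈ Ioc 0 (T p₀), shift q (r • W p₀) ∈ D) :
    ∀ᶠ p in 𝓝 p₀, ∀ r ∈ Ioc 0 (T p), shift q (x p + r • W p) ∈ D := by
  have hpos : ∀ᶠ p in 𝓝 p₀, 0 < T p := hT.eventually (lt_mem_nhds hT0)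
  -- Rescaling time to the fixed compact interval `[0, 1]` reduces the claim to each `θ` separately.
  -- For `θ > 0` openness of `D` suffices; at `θ = 0` the point is on the boundary, and growth of
  -- `f` along the ray puts the later points into `{f > 0}`.
  have hK : ∀ᶠ p in 𝓝 p₀, ∀ θ ∈ Icc (0 : ℝ) 1, 0 < θ → shift q (x p + (θ * T p) • W p) ∈ D := by
    refine isCompact_Icc.eventually_forall_of_forall_eventually fun θ hθ => ?_
    have hx' : Tendsto (fun z : X × ℝ => x z.1) (𝓝 (p₀, θ)) (𝓝 (x p₀)) :=
      hx.tendsto.comp continuous_fst.continuousAt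
    have hW' : Tendsto (fun z : X × ℝ => W z.1) (𝓝 (p₀, θ)) (𝓝 (W p₀)) :=
      hW.tendsto.comp continuous_fst.continuousAt
    have hT' : Tendsto (fun z : X × ℝ => z.2 * T z.1) (𝓝 (p₀, θ)) (𝓝 (θ * T p₀)) :=
      continuous_snd.continuousAt.mul (hT.tendsto.comp continuous_fst.continuousAt)
    have hsum := hx'.add (hT'.smul hW')
    rcases hθ.1.eq_or_lt with rfl | hθ0
    · have h1 := ((hx'.prodMk_nhds (hT'.prodMk_nhds hW')))
      rw [zero_mul, hx0] at h1
      rw [zero_mul, zero_smul, hx0, add_zero] at hsum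
      filter_upwards [h1.eventually (eventually_lt_apply_add_smul hf hfW), hsum.eventually hfD,
        continuous_fst.continuousAt.eventually hfx,
        continuous_fst.continuousAt.eventually hpos] with z hz1 hz2 hz3 hz4 hz5
      have := hz1 (mul_pos hz5 hz4)
      rw [hz3] at this
      exact hz2 this
    · have h1 := (hD.preimage (continuous_shift q)).mem_nhds
        (hray (θ * T p₀) ⟨mul_pos hθ0 hT0, by nlinarith [hθ.2]⟩)
      rw [hx0, zero_add] at hsum
      filter_upwards [hsum.eventually h1] with z hz _
      exact hz
  filter_upwards [hK, hpos] with p hp hp0 r hr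
  have := hp (r / T p) ⟨(div_pos hr.1 hp0).le, (div_le_one hp0).2 hr.2⟩ (div_pos hr.1 hp0)
  rwa [div_mul_cancel₀ _ hp0.ne'] at this

/-- The unit normal field of the level sets of `f`. -/
noncomputable def unitNormal (f : Euc d → ℝ) (x : Euc d) : Euc d :=
  ‖gradient f x‖⁻¹ • gradient f x

lemma contDiffAt_gradient {f : Euc d → ℝ} {x : Euc d} (hf : ContDiffAt ℝ 3 f x) :
    ContDiffAt ℝ 1 (gradient f) x :=
  (InnerProductSpace.toDual ℝ (Euc d)).symm.contDiff.contDiffAt.comp x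
    (hf.fderiv_right (by norm_num))

lemma contDiffAt_unitNormal {f : Euc d → ℝ} {x : Euc d} (hf : ContDiffAt ℝ 3 f x)
    (hx : gradient f x ≠ 0) : ContDiffAt ℝ 1 (unitNormal f) x :=
  ((contDiffAt_gradient hf).norm ℝ hx).inv (norm_ne_zero_iff.2 hx) |>.smul (contDiffAt_gradient hf)

lemma eventually_isInnerNormal {q : Euc d ⧸ L} {f : Euc d → ℝ} (hf : ContDiffAt ℝ 3 f 0)
    (hf' : gradient f 0 ≠ 0)
    (hfD : ∀ᶠ x in 𝓝 (0 : Euc d), (0 < f x → shift q x ∈ D) ∧ (f x = 0 → shift q x ∉ D)) :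
    ∀ᶠ x in 𝓝 (0 : Euc d), f x = 0 → IsInnerNormal D (shift q x) (unitNormal f x) := by
  filter_upwards [hf.eventually (by norm_num), hfD.eventually_nhds,
    (contDiffAt_gradient hf).continuousAt.eventually_ne hf'] with x hx1 hx2 hx3 hx0
  have hg : gradient (fun z => f (x + z)) 0 = gradient f x := by
    rw [gradient, fderiv_comp_add_left, add_zero, gradient]
  refine ⟨fun z => f (x + z), ?_, by simpa using hx0, by rwa [hg], by rw [hg]; rfl, ?_⟩
  · refine ContDiffAt.comp (0 : Euc d) (by simpa using hx1) (by fun_prop)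
  · have : Tendsto (fun z => x + z) (𝓝 (0 : Euc d)) (𝓝 x) := by
      have : Continuous fun z : Euc d => x + z := by fun_prop
      simpa using this.tendsto 0
    filter_upwards [this.eventually hx2] with z hz
    rwa [shift_shift]

/-- The time at which a particle with data near `(0, v)` hits the hypersurface `{f = 0}`. -/
lemma exists_hitting_time {f : Euc d → ℝ} (hf : ContDiffAt ℝ 3 f 0) (hf0 : f 0 = 0) {v : Euc d}
    (hv : ⟪gradient f 0, v⟫ ≠ 0) : ∃ s : Vec d → ℝ, ContDiffAt ℝ 1 s 0 ∧ s 0 = 0 ∧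
      ∀ᶠ p in 𝓝 (0 : Vec d), f (p.fst + s p • (v + p.snd)) = 0 := by
  let φ : Vec d × ℝ → ℝ := fun z => f (z.1.fst + z.2 • (v + z.1.snd))
  have hin : ContDiff ℝ 3 fun z : Vec d × ℝ => z.1.fst + z.2 • (v + z.1.snd) := by fun_prop
  have hφ : ContDiffAt ℝ 3 φ (0, 0) :=
    ContDiffAt.comp (0, 0) (by simpa using hf) hin.contDiffAt
  -- The partial derivative in time is `⟪∇f, v⟫`; that it is non-zero is exactly what the implicit
  -- function theorem requires.
  have hder : fderiv ℝ φ (0, 0) ∘SL ContinuousLinearMap.inr ℝ (Vec d) ℝ =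
      ContinuousLinearMap.toSpanSingleton ℝ (⟪gradient f 0, v⟫ : ℝ) := by
    have h1 := ((hφ.differentiableAt (by norm_num)).hasFDerivAt.comp (0 : ℝ)
      (ContinuousLinearMap.inr ℝ (Vec d) ℝ).hasFDerivAt)
    have h2 : HasFDerivAt (fun r : ℝ => f (r • v))
        (innerSL ℝ (gradient f 0) ∘SL ContinuousLinearMap.toSpanSingleton ℝ v) 0 :=
      HasFDerivAt.comp (0 : ℝ)
        (by simpa using (hasStrictFDerivAt_inner_gradient hf (by norm_num)).hasFDerivAt)
        (ContinuousLinearMap.toSpanSingleton ℝ v).hasFDerivAt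
    have h3 : φ ∘ Prod.mk (0 : Vec d) = fun r : ℝ => f (r • v) := by
      ext r
      simp [φ]
    rw [h3] at h1
    rw [h1.unique h2]
    ext
    simp
  have hinv : (fderiv ℝ φ (0, 0) ∘SL ContinuousLinearMap.inr ℝ (Vec d) ℝ).IsInvertible := by
    rw [hder]
    refine ⟨ContinuousLinearEquiv.unitsEquivAut ℝ (Units.mk0 _ hv), ?_⟩
    ext
    simp
  refine ⟨hφ.implicitFunction (by norm_num) hinv,
    (hφ.contDiffAt_implicitFunction (by norm_num) hinv).of_le (by norm_num),
    hφ.implicitFunction_apply_self (by norm_num) hinv, ?_⟩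
  filter_upwards [hφ.eventually_apply_implicitFunction (by norm_num) hinv] with p hp
  simpa [φ, hf0] using hp

end Boundary

/-! ### The collision map, its determinant, and forward charts of the flow. -/

section Collision

variable {d : ℕ} {L : AddSubgroup (Euc d)} {D : Set (Euc d ⧸ L)}

/-- The collision point of the particle with data `p` (relative to velocity `v`) that hits the
hypersurface at time `s p`. -/
noncomputable def hitPoint (v : Euc d) (s : Vec d → ℝ) (p : Vec d) : Euc d :=
  p.fst + s p • (v + p.snd)

/-- The velocity after the collision. -/
noncomputable def outVelocity (f : Euc d → ℝ) (v : Euc d) (s : Vec d → ℝ) (p : Vec d) : Euc d :=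
  (v + p.snd) - (2 * ⟪v + p.snd, unitNormal f (hitPoint v s p)⟫) • unitNormal f (hitPoint v s p)

/-- The collision in flat coordinates: free motion up to the collision, reflection, and free motion
back for the same time. -/
noncomputable def collisionMap (f : Euc d → ℝ) (v : Euc d) (s : Vec d → ℝ) (p : Vec d) : Vec d :=
  WithLp.toLp 2 (hitPoint v s p - s p • outVelocity f v s p,
    outVelocity f v s p - outVelocity f v s 0)

variable {f : Euc d → ℝ} {v : Euc d} {s : Vec d → ℝ}

lemma hitPoint_zero (hs0 : s 0 = 0) : hitPoint v s 0 = 0 := by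
  simp [hitPoint, hs0]

lemma contDiffAt_hitPoint (hs : ContDiffAt ℝ 1 s 0) : ContDiffAt ℝ 1 (hitPoint v s) 0 := by
  unfold hitPoint
  fun_prop

lemma contDiffAt_unitNormal_hitPoint (hf : ContDiffAt ℝ 3 f 0) (hf' : gradient f 0 ≠ 0)
    (hs : ContDiffAt ℝ 1 s 0) (hs0 : s 0 = 0) :
    ContDiffAt ℝ 1 (fun p => unitNormal f (hitPoint v s p)) 0 := by
  have h : ContDiffAt ℝ 1 (unitNormal f) (hitPoint v s 0) := by
    rw [hitPoint_zero hs0]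
    exact contDiffAt_unitNormal hf hf'
  exact h.comp (0 : Vec d) (contDiffAt_hitPoint hs)

lemma contDiffAt_outVelocity (hf : ContDiffAt ℝ 3 f 0) (hf' : gradient f 0 ≠ 0)
    (hs : ContDiffAt ℝ 1 s 0) (hs0 : s 0 = 0) : ContDiffAt ℝ 1 (outVelocity f v s) 0 := by
  have hn := contDiffAt_unitNormal_hitPoint (v := v) hf hf' hs hs0
  have hv : ContDiffAt ℝ 1 (fun p : Vec d => v + p.snd) 0 := by fun_prop
  exact hv.sub ((contDiffAt_const.mul (hv.inner ℝ hn)).smul hn)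

lemma contDiffAt_collisionMap (hf : ContDiffAt ℝ 3 f 0) (hf' : gradient f 0 ≠ 0)
    (hs : ContDiffAt ℝ 1 s 0) (hs0 : s 0 = 0) : ContDiffAt ℝ 1 (collisionMap f v s) 0 :=
  contDiffAt_vec_mk
    ((contDiffAt_hitPoint hs).sub (hs.smul (contDiffAt_outVelocity hf hf' hs hs0)))
    ((contDiffAt_outVelocity hf hf' hs hs0).sub contDiffAt_const)

lemma collisionMap_zero (hs0 : s 0 = 0) : collisionMap f v s 0 = 0 := by
  rw [collisionMap, hitPoint_zero hs0, hs0, zero_smul, sub_self, sub_self]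
  rfl

/-- The reflection in the direction of the unit vector `ν`. -/
noncomputable def reflect (ν : Euc d) : Euc d →ₗ[ℝ] Euc d :=
  LinearMap.id - (2 : ℝ) • ((innerSL ℝ ν : Euc d →L[ℝ] ℝ) : Euc d →ₗ[ℝ] ℝ).smulRight ν

lemma reflect_apply (ν x : Euc d) : reflect ν x = x - (2 * ⟪ν, x⟫) • ν := by
  simp [reflect, smul_smul]

lemma reflect_reflect {ν : Euc d} (hν : ‖ν‖ = 1) (x : Euc d) : reflect ν (reflect ν x) = x := by
  have : (⟪ν, ν⟫ : ℝ) = 1 := by rw [real_inner_self_eq_norm_sq, hν, one_pow]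
  rw [reflect_apply, reflect_apply, inner_sub_right, inner_smul_right, this]
  module

lemma norm_unitNormal {x : Euc d} (hf' : gradient f x ≠ 0) : ‖unitNormal f x‖ = 1 := by
  rw [unitNormal, norm_smul, norm_inv, norm_norm, inv_mul_cancel₀ (norm_ne_zero_iff.2 hf')]

/-- Flying back for the time `s p` makes the position component `δq + s' (v - v₁) = δq + 2 s' ⟪v, ν⟫
ν` to first order. Differentiating `f = 0` at the hit point gives `⟪ν, δq⟫ + s' ⟪ν, v⟫ = 0`, which
turns this into the reflection of `δq`. If `δq = 0`, then `s' = 0`, the hit point and the normal are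
stationary, and `δv` is just reflected. -/
lemma abs_det_fderiv_collisionMap (hf : ContDiffAt ℝ 3 f 0) (hf' : gradient f 0 ≠ 0)
    (hv : ⟪v, unitNormal f 0⟫ < 0)
    (hs : ContDiffAt ℝ 1 s 0) (hs0 : s 0 = 0) (hfs : ∀ᶠ p in 𝓝 (0 : Vec d), f (hitPoint v s p) = 0) :
    |LinearMap.det (fderiv ℝ (collisionMap f v s) 0 : Vec d →ₗ[ℝ] Vec d)| = 1 := by
  set ν := unitNormal f 0 with hν
  set s' := fderiv ℝ s 0 with hs'
  have hvel : ∀ p : Vec d, HasDerivAt (fun u : ℝ => v + (u • p).snd) p.snd 0 := by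
    intro p
    exact (hasDerivAt_smul_line p.snd).const_add v
  have hx : ∀ p, fderiv ℝ (hitPoint v s) 0 p = p.fst + s' p • v := by
    intro p
    have h1 : HasDerivAt (fun u : ℝ => (u • p).fst) p.fst 0 := by
      exact hasDerivAt_smul_line p.fst
    have h2 := h1.add ((hasDerivAt_along_line hs p).smul (hvel p))
    have h3 := (hasDerivAt_along_line (contDiffAt_hitPoint (v := v) hs) p).unique h2
    simpa [hs0] using h3
  have hνx : ∀ p : Vec d, ⟪ν, p.fst⟫ + s' p * ⟪ν, v⟫ = 0 := by
    intro p
    have h1 : HasFDerivAt f (innerSL ℝ (gradient f 0)) (hitPoint v s ((0 : ℝ) • p)) := by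
      rw [zero_smul, hitPoint_zero hs0]
      exact (hasStrictFDerivAt_inner_gradient hf (by norm_num)).hasFDerivAt
    have h2 := h1.comp_hasDerivAt (0 : ℝ) (hasDerivAt_along_line (contDiffAt_hitPoint (v := v) hs) p)
    have h3 : (f ∘ fun u : ℝ => hitPoint v s (u • p)) =ᶠ[𝓝 0] fun _ => (0 : ℝ) := by
      exact (tendsto_smul_line p).eventually hfs
    have h4 := h2.unique ((hasDerivAt_const (0 : ℝ) (0 : ℝ)).congr_of_eventuallyEq h3)
    rw [hx, innerSL_apply_apply, inner_add_right, inner_smul_right] at h4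
    rw [hν, unitNormal, inner_smul_left, inner_smul_left]
    simp only [conj_trivial]
    linear_combination ‖gradient f 0‖⁻¹ * h4
  have hνv : ⟪ν, v⟫ ≠ 0 := by rw [real_inner_comm]; exact hv.ne
  have hn := contDiffAt_unitNormal_hitPoint (v := v) hf hf' hs hs0
  have hW := contDiffAt_outVelocity (v := v) hf hf' hs hs0
  have hK := contDiffAt_collisionMap (v := v) hf hf' hs hs0
  have hW0 : outVelocity f v s 0 = v - (2 * ⟪v, ν⟫) • ν := by
    simp [outVelocity, hitPoint_zero hs0, hν]
  refine abs_det_eq_one_of_block _ (reflect ν) (reflect_reflect (norm_unitNormal hf')) ?_ ?_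
  · intro p
    have h1 : (fderiv ℝ (collisionMap f v s) 0 p).fst =
        fderiv ℝ (fun p => (collisionMap f v s p).fst) 0 p := by
      rw [fderiv_eq_of_hasFDerivAt
        (hasFDerivAt_vec_fst (hK.differentiableAt (by norm_num)).hasFDerivAt)]
      rfl
    have h2 := (hasDerivAt_along_line (contDiffAt_hitPoint (v := v) hs) p).sub ((hasDerivAt_along_line hs p).smul
      (hasDerivAt_along_line hW p))
    have h3 := (hasDerivAt_along_line (contDiffAt_vec_fst hK) p).unique h2
    rw [ContinuousLinearMap.coe_coe, h1, h3, hx, zero_smul, hs0, hW0, reflect_apply,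
      eq_sub_of_add_eq (hνx p), real_inner_comm v ν]
    module
  · intro b
    set p : Vec d := WithLp.toLp 2 (0, b) with hp
    have hs'p : s' p = 0 := by
      have := hνx p
      rw [hp] at this
      simpa [hνv] using this
    have hxp : fderiv ℝ (hitPoint v s) 0 p = 0 := by
      rw [hx, hs'p, zero_smul, hp]
      simp
    have hnp : HasDerivAt (fun u : ℝ => unitNormal f (hitPoint v s (u • p))) 0 0 := by
      have h1 : HasFDerivAt (unitNormal f) (fderiv ℝ (unitNormal f) 0)
          (hitPoint v s ((0 : ℝ) • p)) := by
        rw [zero_smul, hitPoint_zero hs0]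
        exact ((contDiffAt_unitNormal hf hf').differentiableAt (by norm_num)).hasFDerivAt
      have h2 := h1.comp_hasDerivAt (0 : ℝ) (hasDerivAt_along_line (contDiffAt_hitPoint (v := v) hs) p)
      rwa [hxp, map_zero] at h2
    have h1 : (fderiv ℝ (collisionMap f v s) 0 p).snd =
        fderiv ℝ (fun p => (collisionMap f v s p).snd) 0 p := by
      rw [fderiv_eq_of_hasFDerivAt
        (hasFDerivAt_vec_snd (hK.differentiableAt (by norm_num)).hasFDerivAt)]
      rfl
    have h2 := (((hvel p).sub ((((hvel p).inner ℝ hnp).const_mul (2 : ℝ)).smul hnp))).sub_const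
      (outVelocity f v s 0)
    have h3 := (hasDerivAt_along_line (contDiffAt_vec_snd hK) p).unique h2
    rw [ContinuousLinearMap.coe_coe, h1, h3, reflect_apply, hν]
    simp [hitPoint_zero hs0, hp, real_inner_comm b]

/-- In flat coordinates around `y` and `y'`, the billiard motion for the time `t ≥ 0` is the `C¹` map
`G`, which preserves the volume infinitesimally. -/
structure IsLocalFlowChart (D : Set (Euc d ⧸ L)) (t : ℝ) (y y' : Phase L) (G : Vec d → Vec d) :
    Prop where
  contDiffAt : ContDiffAt ℝ 1 G 0
  map_zero : G 0 = 0
  abs_det : |LinearMap.det (fderiv ℝ G 0 : Vec d →ₗ[ℝ] Vec d)| = 1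
  reaches : ∀ᶠ p in 𝓝 (0 : Vec d), Reaches D (y.shift p) t (y'.shift (G p))

lemma phase_shift_fst (y : Phase L) (p : Vec d) : (y.shift p).fst = shift y.fst p.fst := rfl

lemma phase_shift_snd (y : Phase L) (p : Vec d) : (y.shift p).snd = y.snd + p.snd := rfl

lemma abs_det_fderiv_comp {G G' : Vec d → Vec d} (hG : ContDiffAt ℝ 1 G 0)
    (hG' : ContDiffAt ℝ 1 G' 0) (h0 : G 0 = 0)
    (h1 : |LinearMap.det (fderiv ℝ G 0 : Vec d →ₗ[ℝ] Vec d)| = 1)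
    (h2 : |LinearMap.det (fderiv ℝ G' 0 : Vec d →ₗ[ℝ] Vec d)| = 1) :
    |LinearMap.det (fderiv ℝ (G' ∘ G) 0 : Vec d →ₗ[ℝ] Vec d)| = 1 := by
  rw [fderiv_comp 0 (by rw [h0]; exact hG'.differentiableAt (by norm_num))
    (hG.differentiableAt (by norm_num)), h0]
  change |LinearMap.det ((fderiv ℝ G' 0 : Vec d →ₗ[ℝ] Vec d) ∘ₗ
    (fderiv ℝ G 0 : Vec d →ₗ[ℝ] Vec d))| = 1
  rw [LinearMap.det_comp, abs_mul, h1, h2, one_mul]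

lemma abs_det_fderiv_freeMotion (t : ℝ) :
    |LinearMap.det (fderiv ℝ (freeMotion d t) 0 : Vec d →ₗ[ℝ] Vec d)| = 1 := by
  have h : fderiv ℝ (freeMotion d t) 0 = freeMotion d t := 
    fderiv_eq_of_hasFDerivAt (freeMotion d t).hasFDerivAt
  rw [h, det_freeMotion, abs_one]

lemma IsLocalFlowChart.trans {y y' y'' : Phase L} {t t' : ℝ} {G G' : Vec d → Vec d}
    (h : IsLocalFlowChart D t y y' G) (h' : IsLocalFlowChart D t' y' y'' G') :
    IsLocalFlowChart D (t + t') y y'' (G' ∘ G) where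
  contDiffAt := ContDiffAt.comp 0 (by rw [h.map_zero]; exact h'.contDiffAt) h.contDiffAt
  map_zero := by rw [Function.comp_apply, h.map_zero, h'.map_zero]
  abs_det := abs_det_fderiv_comp h.contDiffAt h'.contDiffAt h.map_zero h.abs_det h'.abs_det
  reaches := by
    have : Tendsto G (𝓝 0) (𝓝 0) := by
      simpa [h.map_zero] using h.contDiffAt.continuousAt.tendsto
    filter_upwards [h.reaches, this.eventually h'.reaches] with p h1 h2 using h1.trans h2

lemma isLocalFlowChart_free (hD : IsOpen D) (q : Euc d ⧸ L) (v : Euc d) {t : ℝ} (ht : 0 ≤ t)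
    (hfree : ∀ s ∈ Icc 0 t, shift q (s • v) ∈ D) :
    IsLocalFlowChart D t (WithLp.toLp 2 (q, v)) (WithLp.toLp 2 (shift q (t • v), v))
      (freeMotion d t) where
  contDiffAt := (freeMotion d t).contDiff.contDiffAt
  map_zero := map_zero _
  abs_det := abs_det_fderiv_freeMotion t
  reaches := by
    have hK : ∀ᶠ p in 𝓝 (0 : Vec d), ∀ s ∈ Icc 0 t, shift q (p.fst + s • (v + p.snd)) ∈ D := by
      refine isCompact_Icc.eventually_forall_of_forall_eventually fun s hs => ?_
      have hc : Tendsto (fun z : Vec d × ℝ => z.1.fst + z.2 • (v + z.1.snd)) (𝓝 (0, s))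
          (𝓝 (s • v)) := by
        have h1 : ContDiff ℝ 1 fun z : Vec d × ℝ => z.1.fst + z.2 • (v + z.1.snd) := by fun_prop
        simpa using h1.continuous.tendsto ((0 : Vec d), s)
      exact hc.eventually ((hD.preimage (continuous_shift q)).mem_nhds (hfree s hs))
    filter_upwards [hK] with p hp
    have := Reaches.free (D := D) (shift q p.fst) (v + p.snd) t ht
      (fun s hs => by rw [shift_shift]; exact hp s hs)
    have e : Phase.shift (WithLp.toLp 2 (shift q (t • v), v)) (freeMotion d t p) =
        WithLp.toLp 2 (shift (shift q p.fst) (t • (v + p.snd)), v + p.snd) := by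
      refine phase_ext ?_ rfl
      change shift (shift q (t • v)) (p.fst + t • p.snd) = shift (shift q p.fst) (t • (v + p.snd))
      rw [shift_shift, shift_shift]
      congr 1
      module
    rw [e]
    exact this

lemma exists_isLocalFlowChart_collide (hD : IsOpen D) {q : Euc d ⧸ L} {v : Euc d}
    {σ τ : ℝ} (hσ : 0 < σ) (hτ : 0 < τ) {q₁ : Euc d ⧸ L} {v₁ ν : Euc d}
    (hin : ∀ s ∈ Ico 0 σ, shift q (s • v) ∈ D) (hq₁ : q₁ = shift q (σ • v))
    (hν : IsInnerNormal D q₁ ν) (hv : ⟪v, ν⟫ < 0) (hv₁ : v₁ = v - (2 * ⟪v, ν⟫) • ν)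
    (hout : ∀ s ∈ Ioc 0 τ, shift q₁ (s • v₁) ∈ D) :
    ∃ G, IsLocalFlowChart D (σ + τ) (WithLp.toLp 2 (q, v))
      (WithLp.toLp 2 (shift q₁ (τ • v₁), v₁)) G := by
  have hν1 := hν.norm_eq_one
  obtain ⟨f, hf, hf0, hf', hνf, hfD⟩ := hν
  replace hνf : ν = unitNormal f 0 := hνf
  have hνν : (⟪ν, ν⟫ : ℝ) = 1 := by rw [real_inner_self_eq_norm_sq, hν1, one_pow]
  have hgν : gradient f 0 = ‖gradient f 0‖ • ν := by
    rw [hνf, unitNormal, smul_smul, mul_inv_cancel₀ (norm_ne_zero_iff.2 hf'), one_smul]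
  have hg0 : 0 < ‖gradient f 0‖ := norm_pos_iff.2 hf'
  have hgv : ⟪gradient f 0, v⟫ < 0 := by
    rw [hgν, inner_smul_left, real_inner_comm]
    exact mul_neg_of_pos_of_neg hg0 hv
  obtain ⟨s, hs, hs0, hfs⟩ := exists_hitting_time hf hf0 hgv.ne
  have hfs' : ∀ᶠ p in 𝓝 (0 : Vec d), f (hitPoint v s p) = 0 := hfs
  have hx0 := hitPoint_zero (v := v) hs0
  have hxc := (contDiffAt_hitPoint (v := v) hs).continuousAt
  have hWc := (contDiffAt_outVelocity (v := v) hf hf' hs hs0).continuousAt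
  have hnc := (contDiffAt_unitNormal_hitPoint (v := v) hf hf' hs hs0).continuousAt
  have hW0 : outVelocity f v s 0 = v₁ := by
    simp [outVelocity, hx0, hv₁, hνf]
  have hvc : ContinuousAt (fun p : Vec d => v + p.snd) 0 :=
    ContDiffAt.continuousAt (𝕜 := ℝ) (n := 1) (by fun_prop)
  have hf1 := hasStrictFDerivAt_inner_gradient hf (by norm_num)
  have h_in : ∀ᶠ p in 𝓝 (0 : Vec d), ∀ r ∈ Ioc 0 (σ + s p),
      shift q₁ (hitPoint v s p + r • -(v + p.snd)) ∈ D := by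
    -- The incoming flight, run backwards from the hit point, is a ray that leaves the boundary into
    -- `D`, so it is treated like the outgoing one.
    refine eventually_ray_mem hD hf1 (hfD.mono fun _ h => h.1) hxc hvc.neg
      (continuousAt_const.add hs.continuousAt) hx0 (by simpa [hs0] using hσ) hfs' ?_ ?_
    · simpa using hgv
    · intro r hr
      rw [hs0, add_zero] at hr
      have := hin (σ - r) ⟨by linarith [hr.2], by linarith [hr.1]⟩
      rw [hq₁, shift_shift]
      convert this using 2
      rw [WithLp.zero_snd]
      module
  have h_out : ∀ᶠ p in 𝓝 (0 : Vec d), ∀ r ∈ Ioc 0 (τ - s p),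
      shift q₁ (hitPoint v s p + r • outVelocity f v s p) ∈ D := by
    refine eventually_ray_mem hD hf1 (hfD.mono fun _ h => h.1) hxc hWc
      (continuousAt_const.sub hs.continuousAt) hx0 (by simpa [hs0] using hτ) hfs' ?_ ?_
    · rw [hW0, innerSL_apply_apply, hv₁, hgν, inner_smul_left, inner_sub_right, inner_smul_right,
        hνν, real_inner_comm]
      refine mul_pos (by simpa using hf') ?_
      linarith
    · rw [hs0, sub_zero, hW0]
      exact hout
  have hinner : ∀ᶠ p in 𝓝 (0 : Vec d), ⟪v + p.snd, unitNormal f (hitPoint v s p)⟫ < 0 := by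
    refine (hvc.inner (𝕜 := ℝ) hnc).eventually (gt_mem_nhds ?_)
    simpa [hx0, ← hνf] using hv
  have hnormal := hxc.tendsto.eventually
    (by rw [hx0]; exact eventually_isInnerNormal hf hf' hfD)
  have hσp : ∀ᶠ p in 𝓝 (0 : Vec d), 0 < σ + s p :=
    (continuousAt_const.add hs.continuousAt).eventually (lt_mem_nhds (by simpa [hs0] using hσ))
  have hτp : ∀ᶠ p in 𝓝 (0 : Vec d), 0 < τ - s p :=
    (continuousAt_const.sub hs.continuousAt).eventually (lt_mem_nhds (by simpa [hs0] using hτ))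
  have hK1 := contDiffAt_collisionMap (v := v) hf hf' hs hs0
  have hK0 := collisionMap_zero (f := f) (v := v) hs0
  have hKσ : ContDiffAt ℝ 1 (collisionMap f v s ∘ freeMotion d σ) 0 :=
    ContDiffAt.comp 0 (by rwa [map_zero]) (freeMotion d σ).contDiff.contDiffAt
  have hKσ0 : (collisionMap f v s ∘ freeMotion d σ) 0 = 0 := by
    rw [Function.comp_apply, map_zero, hK0]
  -- The particle is moved for the time `σ` as if there were no boundary, corrected by the collision
  -- map, and moved on for `τ`. The true collision takes place at time `σ + s P`, where `s P` may
  -- have either sign.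
  refine ⟨freeMotion d τ ∘ (collisionMap f v s ∘ freeMotion d σ),
    (freeMotion d τ).contDiff.contDiffAt.comp 0 hKσ,
    by rw [Function.comp_apply, hKσ0, map_zero],
    abs_det_fderiv_comp hKσ (freeMotion d τ).contDiff.contDiffAt hKσ0
      (abs_det_fderiv_comp (freeMotion d σ).contDiff.contDiffAt hK1 (map_zero _)
        (abs_det_fderiv_freeMotion σ)
        (abs_det_fderiv_collisionMap hf hf' (hνf ▸ hv) hs hs0 hfs'))
      (abs_det_fderiv_freeMotion τ), ?_⟩
  have hlim : Tendsto (freeMotion d σ) (𝓝 0) (𝓝 0) :=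
    (freeMotion d σ).continuous.tendsto' 0 0 (map_zero _)
  filter_upwards [hlim.eventually h_in, hlim.eventually h_out, hlim.eventually hinner,
    hlim.eventually hnormal, hlim.eventually hfs', hlim.eventually hσp,
    hlim.eventually hτp] with p p1 p2 p3 p4 p5 p6 p7
  simp only [Function.comp_apply]
  set P := freeMotion d σ p with hP
  have hPs : P.snd = p.snd := rfl
  have hPf : P.fst = p.fst + σ • p.snd := rfl
  set x := hitPoint v s P with hx
  set W := outVelocity f v s P with hW
  have key : ∀ r : ℝ, shift (shift q p.fst) (r • (v + p.snd)) =
      shift q₁ (x + (σ + s P - r) • -(v + P.snd)) := by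
    intro r
    rw [hq₁, shift_shift, shift_shift, hx, hitPoint, hPs, hPf]
    congr 1
    module
  have hstart : Reaches D (Phase.shift (WithLp.toLp 2 (q, v)) p) 0
      (WithLp.toLp 2 (shift q p.fst, v + p.snd)) := by
    refine reaches_zero ?_
    have := p1 (σ + s P) ⟨p6, le_rfl⟩
    have h2 := key 0
    rw [zero_smul, shift_zero, sub_zero] at h2
    rwa [← h2] at this
  have := Reaches.collide _ 0 _ _ hstart (σ + s P) (τ - s P) p6 p7 (shift q₁ x) W
    (unitNormal f x)
    (fun r hr => by
      rw [key]
      exact p1 _ ⟨by linarith [hr.2], by linarith [hr.1]⟩)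
    (by rw [key, sub_self, zero_smul, add_zero]) (p4 p5) p3 rfl
    (fun r hr => by
      rw [shift_shift]
      exact p2 r hr)
  rw [show 0 + (σ + s P) + (τ - s P) = σ + τ by ring] at this
  have e : Phase.shift (WithLp.toLp 2 (shift q₁ (τ • v₁), v₁))
      (freeMotion d τ (collisionMap f v s P)) =
      WithLp.toLp 2 (shift (shift q₁ x) ((τ - s P) • W), W) := by
    refine phase_ext ?_ ?_
    · change shift (shift q₁ (τ • v₁))
        ((x - s P • W) + τ • (W - outVelocity f v s 0)) = shift (shift q₁ x) ((τ - s P) • W)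
      rw [hW0, shift_shift, shift_shift]
      congr 1
      module
    · change v₁ + (W - outVelocity f v s 0) = W
      rw [hW0]
      abel
  rw [e]
  exact this

lemma Reaches.exists_isLocalFlowChart (hD : IsOpen D) {y y' : Phase L} {t : ℝ}
    (h : Reaches D y t y') : ∃ G, IsLocalFlowChart D t y y' G := by
  induction h with
  | free q v t ht hfree => exact ⟨_, isLocalFlowChart_free hD q v ht hfree⟩
  | collide y t q v hy σ τ hσ hτ q₁ v₁ ν hin hq₁ hν hv hv₁ hout ih =>
    obtain ⟨G, hG⟩ := ih
    obtain ⟨G', hG'⟩ := exists_isLocalFlowChart_collide hD hσ hτ hin hq₁ hν hv hv₁ hout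
    rw [add_assoc]
    exact ⟨_, hG.trans hG'⟩

end Collision

/-! ### Flat coordinates, invertible flow charts, derivative and image hypersurface. -/

section Charts

variable {d : ℕ} {L : AddSubgroup (Euc d)} {D : Set (Euc d ⧸ L)}

lemma exists_norm_mk_eq (L : AddSubgroup (Euc d)) [DiscreteTopology L] :
    ∃ r > 0, ∀ x : Euc d, ‖x‖ < r → ‖(QuotientAddGroup.mk x : Euc d ⧸ L)‖ = ‖x‖ := by
  obtain ⟨δ, hδ, hL⟩ : ∃ δ > 0, ∀ l ∈ L, ‖l‖ < δ → l = 0 := by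
    have h := (isOpen_discrete ({0} : Set L)).mem_nhds rfl
    obtain ⟨δ, hδ, h⟩ := Metric.mem_nhds_iff.1 h
    refine ⟨δ, hδ, fun l hl hlt => ?_⟩
    have : (⟨l, hl⟩ : L) ∈ ({0} : Set L) := h (by simpa [Metric.mem_ball, dist_eq_norm] using hlt)
    simpa using this
  -- A strictly shorter representative of the class of `x` would differ from `x` by an element of
  -- `L` of norm less than `δ`, hence by zero.
  refine ⟨δ / 2, by positivity, fun x hx => le_antisymm (QuotientAddGroup.norm_mk_le_norm) ?_⟩
  rw [QuotientAddGroup.le_norm_iff]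
  intro m hm
  have hl : -x + m ∈ L := QuotientAddGroup.eq.1 hm.symm
  by_contra! hlt
  have h0 : -x + m = 0 := hL _ hl (by
    calc ‖-x + m‖ ≤ ‖-x‖ + ‖m‖ := norm_add_le _ _
      _ < δ := by rw [norm_neg]; linarith)
  rw [neg_add_eq_zero.1 h0] at hlt
  exact lt_irrefl _ hlt

/-- The flat coordinates are locally isometric. -/
lemma exists_dist_phase_shift_eq (L : AddSubgroup (Euc d)) [DiscreteTopology L] :
    ∃ r > 0, ∀ (y : Phase L) (p p' : Vec d), ‖p‖ < r → ‖p'‖ < r →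
      dist (y.shift p) (y.shift p') = dist p p' := by
  obtain ⟨r, hr, h⟩ := exists_norm_mk_eq L
  refine ⟨r / 2, by positivity, fun y p p' hp hp' => ?_⟩
  have h1 : dist (y.shift p).fst (y.shift p').fst = dist p.fst p'.fst := by
    rw [phase_shift_fst, phase_shift_fst, shift, shift, dist_add_left, dist_eq_norm, dist_eq_norm,
      ← QuotientAddGroup.mk_sub, h]
    calc ‖p.fst - p'.fst‖ = ‖(p - p').fst‖ := rfl
      _ ≤ ‖p - p'‖ := WithLp.norm_fst_le _ _
      _ ≤ ‖p‖ + ‖p'‖ := norm_sub_le _ _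
      _ < r := by linarith
  have h2 : dist (y.shift p).snd (y.shift p').snd = dist p.snd p'.snd := by
    rw [phase_shift_snd, phase_shift_snd, dist_add_left]
  rw [WithLp.prod_dist_eq_of_L2, WithLp.prod_dist_eq_of_L2, h1, h2]

lemma map_phase_shift_nhds (y : Phase L) : map y.shift (𝓝 0) = 𝓝 y := by
  have h1 : map (shift y.fst) (𝓝 0) = 𝓝 y.fst := by
    have hc := continuous_shift y.fst
    have ho : IsOpenMap (shift y.fst) :=
      (Homeomorph.addLeft y.fst).isOpenMap.comp QuotientAddGroup.isOpenMap_coe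
    simpa [shift_zero] using ho.map_nhds_eq hc.continuousAt (x := 0)
  have h2 : map (fun b => y.snd + b) (𝓝 0) = 𝓝 y.snd := by
    simp
  have h3 : map (WithLp.ofLp : Vec d → Euc d × Euc d) (𝓝 0) = 𝓝 0 ×ˢ 𝓝 0 := by
    rw [← nhds_prod_eq]
    exact (WithLp.homeomorphProd 2 (Euc d) (Euc d)).map_nhds_eq 0
  have h4 : map (WithLp.toLp 2 : (Euc d ⧸ L) × Euc d → Phase L) (𝓝 y.fst ×ˢ 𝓝 y.snd) = 𝓝 y := by
    rw [← nhds_prod_eq]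
    exact (WithLp.homeomorphProd 2 (Euc d ⧸ L) (Euc d)).symm.map_nhds_eq (y.fst, y.snd)
  have h5 : y.shift = WithLp.toLp 2 ∘ Prod.map (shift y.fst) (fun b => y.snd + b) ∘ WithLp.ofLp :=
    rfl
  rw [h5, ← Filter.map_map, ← Filter.map_map, h3, ← Filter.prod_map_map_eq', h1, h2, h4]

lemma tendsto_phase_shift (y : Phase L) : Tendsto y.shift (𝓝 0) (𝓝 y) :=
  (map_phase_shift_nhds y).le

/-- Determinism identifies points of the phase space; this turns it into equality of their
displacements. -/
lemma eventually_phase_shift_inj [DiscreteTopology L] (y : Phase L) :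
    ∀ᶠ z : Vec d × Vec d in 𝓝 (0, 0), y.shift z.1 = y.shift z.2 → z.1 = z.2 := by
  obtain ⟨r, hr, h⟩ := exists_dist_phase_shift_eq L
  have hb := Metric.ball_mem_nhds (0 : Vec d) hr
  filter_upwards [prod_mem_nhds hb hb] with z hz heq
  have := h y z.1 z.2 (by simpa using hz.1) (by simpa using hz.2)
  rw [heq, dist_self] at this
  exact dist_eq_zero.1 this.symm

/-- The map `(δq, δv) ↦ (δq, -δv)`. -/
noncomputable def velocityNeg (d : ℕ) : Vec d →L[ℝ] Vec d :=
  (WithLp.prodContinuousLinearEquiv 2 ℝ (Euc d) (Euc d)).symm.toContinuousLinearMap ∘L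
    (WithLp.fstL 2 ℝ (Euc d) (Euc d)).prod (-WithLp.sndL 2 ℝ (Euc d) (Euc d))

lemma reversal_shift (y : Phase L) (p : Vec d) :
    (reversal y).shift p = reversal (y.shift (velocityNeg d p)) := by
  refine phase_ext rfl ?_
  change -y.snd + p.snd = -(y.snd + -p.snd)
  abel

/-- In flat coordinates around `y` and `y'`, the time-`t` map of the flow is the local
diffeomorphism `G`, whose inverse is `H`. -/
structure IsFlowChart (D : Set (Euc d ⧸ L)) (t : ℝ) (y y' : Phase L) (G H : Vec d → Vec d) :
    Prop where
  contDiffAt : ContDiffAt ℝ 1 G 0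
  contDiffAt_inv : ContDiffAt ℝ 1 H 0
  map_zero : G 0 = 0
  inv_zero : H 0 = 0
  abs_det : |LinearMap.det (fderiv ℝ G 0 : Vec d →ₗ[ℝ] Vec d)| = 1
  flowsTo : ∀ᶠ p in 𝓝 (0 : Vec d), FlowsTo D t (y.shift p) (y'.shift (G p))
  left_inv : ∀ᶠ p in 𝓝 (0 : Vec d), H (G p) = p
  right_inv : ∀ᶠ p in 𝓝 (0 : Vec d), G (H p) = p

variable {t : ℝ} {y y' : Phase L} {G H : Vec d → Vec d}

lemma IsFlowChart.tendsto (h : IsFlowChart D t y y' G H) : Tendsto G (𝓝 0) (𝓝 0) := by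
  simpa [h.map_zero] using h.contDiffAt.continuousAt.tendsto

lemma IsFlowChart.tendsto_inv (h : IsFlowChart D t y y' G H) : Tendsto H (𝓝 0) (𝓝 0) := by
  simpa [h.inv_zero] using h.contDiffAt_inv.continuousAt.tendsto

lemma IsFlowChart.hasFDerivAt (h : IsFlowChart D t y y' G H) :
    HasFDerivAt G (fderiv ℝ G 0) 0 :=
  (h.contDiffAt.differentiableAt (by norm_num)).hasFDerivAt

lemma IsFlowChart.hasFDerivAt_inv (h : IsFlowChart D t y y' G H) :
    HasFDerivAt H (fderiv ℝ H 0) 0 :=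
  (h.contDiffAt_inv.differentiableAt (by norm_num)).hasFDerivAt

lemma fderiv_apply_fderiv_of_eventually_comp_eq {E : Type*} [NormedAddCommGroup E]
    [NormedSpace ℝ E] {G H : E → E} {G' H' : E →L[ℝ] E} (hG : HasFDerivAt G G' 0)
    (hH : HasFDerivAt H H' 0) (h0 : G 0 = 0) (h : ∀ᶠ p in 𝓝 (0 : E), H (G p) = p) (p : E) :
    H' (G' p) = p := by
  have h1 : HasFDerivAt (H ∘ G) (H' ∘L G') 0 := HasFDerivAt.comp 0 (by rwa [h0]) hG
  have h2 := h1.unique ((hasFDerivAt_id (𝕜 := ℝ) (0 : E)).congr_of_eventuallyEq h)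
  exact congrArg (fun A => A p) h2

lemma IsFlowChart.fderiv_inv_apply (h : IsFlowChart D t y y' G H) (p : Vec d) :
    fderiv ℝ H 0 (fderiv ℝ G 0 p) = p :=
  fderiv_apply_fderiv_of_eventually_comp_eq h.hasFDerivAt h.hasFDerivAt_inv h.map_zero h.left_inv p

lemma IsFlowChart.symm (h : IsFlowChart D t y y' G H) : IsFlowChart D (-t) y' y H G where
  contDiffAt := h.contDiffAt_inv
  contDiffAt_inv := h.contDiffAt
  map_zero := h.inv_zero
  inv_zero := h.map_zero
  abs_det := by
    have h1 : (fderiv ℝ H 0 : Vec d →ₗ[ℝ] Vec d) ∘ₗ (fderiv ℝ G 0 : Vec d →ₗ[ℝ] Vec d) =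
        LinearMap.id := by
      ext1 p
      exact h.fderiv_inv_apply p
    have h2 := congrArg (fun A => |LinearMap.det A|) h1
    simpa only [LinearMap.det_comp, abs_mul, h.abs_det, mul_one, LinearMap.det_id, abs_one] using h2
  flowsTo := by
    filter_upwards [h.tendsto_inv.eventually h.flowsTo, h.right_inv] with p h1 h2
    rw [h2] at h1
    exact h1.symm
  left_inv := h.right_inv
  right_inv := h.left_inv

/-- The reversed orbit also has a forward chart `K`; conjugated with the velocity reversal `N` it
gives the inverse `N ∘ K ∘ N`. No inverse function theorem is needed, as uniqueness of the past and
of the future gives the two inverse relations. -/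
lemma Reaches.exists_isFlowChart [DiscreteTopology L] (hD : IsOpen D) (h : Reaches D y t y') :
    ∃ G H, IsFlowChart D t y y' G H := by
  obtain ⟨G, hG⟩ := h.exists_isLocalFlowChart hD
  obtain ⟨K, hK⟩ := h.reverse.exists_isLocalFlowChart hD
  set N := velocityNeg d
  have hNlim : Tendsto N (𝓝 0) (𝓝 0) := N.continuous.tendsto' 0 0 (_root_.map_zero N)
  have hGlim : Tendsto G (𝓝 0) (𝓝 0) := by
    simpa [hG.map_zero] using hG.contDiffAt.continuousAt.tendsto
  have hKlim : Tendsto K (𝓝 0) (𝓝 0) := by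
    simpa [hK.map_zero] using hK.contDiffAt.continuousAt.tendsto
  have hHlim : Tendsto (fun p => N (K (N p))) (𝓝 0) (𝓝 0) := hNlim.comp (hKlim.comp hNlim)
  have hNN : ∀ p, N (N p) = p := fun p =>
    WithLp.ofLp_injective 2 (Prod.ext rfl (neg_neg _))
  have hHflow : ∀ᶠ p in 𝓝 (0 : Vec d), Reaches D (y.shift (N (K (N p)))) t (y'.shift p) := by
    filter_upwards [hNlim.eventually hK.reaches] with p hp
    have := hp.reverse
    rwa [reversal_shift, reversal_shift, reversal_reversal, reversal_reversal, hNN] at this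
  have hH0 : N (K (N 0)) = 0 := by
    rw [_root_.map_zero, hK.map_zero, _root_.map_zero]
  refine ⟨G, fun p => N (K (N p)), hG.contDiffAt, ?_, hG.map_zero, hH0, hG.abs_det,
    hG.reaches.mono fun p hp => Or.inl ⟨h.nonneg, hp⟩, ?_, ?_⟩
  · have h1 : ContDiffAt ℝ 1 (K ∘ N) 0 :=
      ContDiffAt.comp 0 (by rw [_root_.map_zero]; exact hK.contDiffAt) N.contDiff.contDiffAt
    exact N.contDiff.contDiffAt.comp 0 h1
  · filter_upwards [hG.reaches, hGlim.eventually hHflow,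
      ((hHlim.comp hGlim).prodMk_nhds tendsto_id).eventually (eventually_phase_shift_inj y)]
      with p h1 h2 h3
    refine h3 ?_
    have := h1.reverse.unique h2.reverse
    have e : y.shift (N (K (N (G p)))) = y.shift p := by
      rw [← reversal_reversal (y.shift p), this, reversal_reversal]
    exact e
  · filter_upwards [hHflow, hHlim.eventually hG.reaches,
      ((hGlim.comp hHlim).prodMk_nhds tendsto_id).eventually (eventually_phase_shift_inj y')]
      with p h1 h2 h3
    exact h3 (h2.unique h1)

lemma FlowsTo.exists_isFlowChart [DiscreteTopology L] (hD : IsOpen D) (h : FlowsTo D t y y') :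
    ∃ G H, IsFlowChart D t y y' G H := by
  rcases h with ⟨-, h⟩ | ⟨-, h⟩
  · exact h.exists_isFlowChart hD
  · obtain ⟨G, H, hGH⟩ := h.exists_isFlowChart hD
    exact ⟨H, G, by simpa using hGH.symm⟩

/-- The derivative of the flow preserves `⟪δv, v⟫`, as the flow preserves the speed. -/
lemma IsFlowChart.inner_fderiv_snd (h : IsFlowChart D t y y' G H) (ξ : Vec d) :
    ⟪(fderiv ℝ G 0 ξ).snd, y'.snd⟫ = ⟪ξ.snd, y.snd⟫ := by
  have h1 : (fun u : ℝ => ‖y'.snd + (G (u • ξ)).snd‖ ^ 2) =ᶠ[𝓝 0]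
      fun u => ‖y.snd + (u • ξ).snd‖ ^ 2 := by
    filter_upwards [(tendsto_smul_line ξ).eventually h.flowsTo] with u hu
    have := hu.norm_snd
    rw [phase_shift_snd, phase_shift_snd] at this
    rw [this]
  have h2 : HasDerivAt (fun u : ℝ => y.snd + (u • ξ).snd) ξ.snd 0 :=
    (hasDerivAt_smul_line ξ.snd).const_add _
  have h3 : HasDerivAt (fun u : ℝ => y'.snd + (G (u • ξ)).snd) (fderiv ℝ G 0 ξ).snd 0 :=
    ((WithLp.sndL 2 ℝ (Euc d) (Euc d)).hasFDerivAt.comp_hasDerivAt (0 : ℝ)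
      (hasDerivAt_along_line h.contDiffAt ξ)).const_add _
  have h4 := h3.norm_sq.unique (h2.norm_sq.congr_of_eventuallyEq h1)
  rw [zero_smul, h.map_zero, WithLp.zero_snd, add_zero, add_zero] at h4
  rw [real_inner_comm, real_inner_comm y.snd]
  linarith

/-- The derivative of the flow as a map of the tangent spaces of the phase space. -/
noncomputable def IsFlowChart.tangentEquiv (h : IsFlowChart D t y y' G H) :
    tangentSpace y ≃ₗ[ℝ] tangentSpace y' where
  toFun ξ := ⟨fderiv ℝ G 0 ξ, (h.inner_fderiv_snd ξ).trans ξ.2⟩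
  invFun ξ := ⟨fderiv ℝ H 0 ξ, (h.symm.inner_fderiv_snd ξ).trans ξ.2⟩
  map_add' ξ η := Subtype.ext (map_add (fderiv ℝ G 0) (ξ : Vec d) η)
  map_smul' c ξ := Subtype.ext (map_smul (fderiv ℝ G 0) c (ξ : Vec d))
  left_inv ξ := Subtype.ext (h.fderiv_inv_apply ξ)
  right_inv ξ := Subtype.ext (h.symm.fderiv_inv_apply ξ)

lemma IsFlowChart.flow_eq (h : IsFlowChart D t y y' G H) :
    ∀ᶠ p in 𝓝 (0 : Vec d), flow D t (y.shift p) = y'.shift (G p) :=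
  h.flowsTo.mono fun _ hp => hp.flow_eq

lemma IsFlowChart.hasTangentMapAt (h : IsFlowChart D t y y' G H) :
    HasTangentMapAt (flow D t) y y' h.tangentEquiv.toLinearMap :=
  ⟨G, fderiv ℝ G 0, h.map_zero, h.flow_eq.filter_mono nhdsWithin_le_nhds,
    h.hasFDerivAt.hasFDerivWithinAt, fun _ => rfl⟩

lemma IsFlowChart.tendsto_inv_unit (h : IsFlowChart D t y y' G H) :
    Tendsto H (𝓝[unitDisplacements y'] 0) (𝓝[unitDisplacements y] 0) := by
  refine tendsto_nhdsWithin_iff.2 ⟨h.tendsto_inv.mono_left nhdsWithin_le_nhds, ?_⟩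
  filter_upwards [h.symm.flowsTo.filter_mono nhdsWithin_le_nhds, self_mem_nhdsWithin] with p h1 h2
  exact h1.norm_snd.trans h2

/-- The image is cut out by the defining function of `J` composed with `H`. Remote parts of `J`
cannot land near `y'`: the only point that flows to the displacement `p` from `y'` is the
displacement `H p` from `y`. -/
lemma IsFlowChart.isHypersurfaceAt (h : IsFlowChart D t y y' G H) {J : Set (Phase L)}
    (hJ : J ⊆ phaseSpace D) {T : Submodule ℝ (tangentSpace y)} (hT : IsHypersurfaceAt J y T) :
    IsHypersurfaceAt (flowImage D t J) y' (T.map h.tangentEquiv.toLinearMap) := by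
  obtain ⟨k, hk, hk0, hkJ, ⟨ξ, hξ⟩, hkT⟩ := hT
  have hkH : ContDiffAt ℝ 1 (k ∘ H) 0 :=
    ContDiffAt.comp 0 (by rw [h.inv_zero]; exact hk) h.contDiffAt_inv
  have hder : ∀ η : Vec d, fderiv ℝ (k ∘ H) 0 η = fderiv ℝ k 0 (fderiv ℝ H 0 η) := by
    intro η
    have h1 : HasFDerivAt (k ∘ H) (fderiv ℝ k 0 ∘L fderiv ℝ H 0) 0 :=
      HasFDerivAt.comp 0 (by
        rw [h.inv_zero]
        exact (hk.differentiableAt (by norm_num)).hasFDerivAt) h.hasFDerivAt_inv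
    rw [fderiv_eq_of_hasFDerivAt h1]
    rfl
  refine ⟨k ∘ H, hkH, by rw [Function.comp_apply, h.inv_zero, hk0], ?_,
    ⟨h.tangentEquiv ξ, ?_⟩, fun η => ?_⟩
  · filter_upwards [h.tendsto_inv_unit.eventually hkJ,
      h.symm.flowsTo.filter_mono nhdsWithin_le_nhds] with p h1 h2
    have h2' : FlowsTo D t (y.shift (H p)) (y'.shift p) := by simpa using h2.symm
    rw [Function.comp_apply, ← h1]
    constructor
    · rintro ⟨z, ⟨hzJ, hzD⟩, hz⟩
      have h3 := flowsTo_flow hzD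
      rw [hz] at h3
      rwa [← h3.symm.unique h2]
    · exact fun hJp => ⟨_, ⟨hJp, hJ hJp, _, h2'⟩, h2'.flow_eq⟩
  · rw [hder]
    change fderiv ℝ k 0 (fderiv ℝ H 0 (fderiv ℝ G 0 ξ)) ≠ 0
    rwa [h.fderiv_inv_apply]
  · rw [hder]
    change _ ↔ fderiv ℝ k 0 (h.tangentEquiv.symm η : Vec d) = 0
    rw [← hkT]
    exact Submodule.mem_map_equiv (e := h.tangentEquiv) T

end Charts

/-! ### Hausdorff measure under Lipschitz comparison and on hyperplanes. -/

section Hausdorff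

/-- The inequality makes `b` factor through `a` on `S`, by a map that is `K`-Lipschitz on the image
of `a`. Indexing both images by `S` lets a set be compared with its projection in either direction.
-/
lemma hausdorffMeasure_image_le_of_dist_le {ι X Y : Type*} [MetricSpace X] [MetricSpace Y]
    [MeasurableSpace X] [BorelSpace X] [MeasurableSpace Y] [BorelSpace Y] {S : Set ι} {a : ι → X}
    {b : ι → Y} {K : ℝ} (hK : 0 ≤ K)
    (h : ∀ i ∈ S, ∀ j ∈ S, dist (b i) (b j) ≤ K * dist (a i) (a j)) (m : ℕ) :
    μH[m] (b '' S) ≤ ENNReal.ofReal (K ^ m) * μH[m] (a '' S) := by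
  rcases S.eq_empty_or_nonempty with rfl | ⟨i₀, hi₀⟩
  · simp
  have : Nonempty ι := ⟨i₀⟩
  set g := Function.invFunOn a S with hg
  have hgS : ∀ i ∈ S, g (a i) ∈ S ∧ a (g (a i)) = a i := fun i hi =>
    ⟨Function.invFunOn_mem ⟨i, hi, rfl⟩, Function.invFunOn_eq ⟨i, hi, rfl⟩⟩
  have himg : (b ∘ g) '' (a '' S) = b '' S := by
    rw [← image_comp]
    refine image_congr fun i hi => ?_
    have := h _ (hgS i hi).1 _ hi
    rw [(hgS i hi).2, dist_self, mul_zero] at this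
    exact dist_le_zero.1 this
  have hlip : LipschitzOnWith K.toNNReal (b ∘ g) (a '' S) := by
    refine LipschitzOnWith.of_dist_le_mul ?_
    rintro _ ⟨i, hi, rfl⟩ _ ⟨j, hj, rfl⟩
    have := h _ (hgS i hi).1 _ (hgS j hj).1
    rw [(hgS i hi).2, (hgS j hj).2] at this
    rwa [Real.coe_toNNReal K hK]
  have := hlip.hausdorffMeasure_image_le (d := m) (Nat.cast_nonneg m)
  rwa [himg, ENNReal.rpow_natCast, ← ENNReal.ofReal, ← ENNReal.ofReal_pow hK] at this

lemma hausdorffMeasure_submodule_image_coe {V : Type*} [NormedAddCommGroup V]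
    [InnerProductSpace ℝ V] [MeasurableSpace V] [BorelSpace V] (T : Submodule ℝ V) (m : ℕ)
    (E : Set T) : μH[m] ((↑) '' E : Set V) = μH[m] E :=
  isometry_subtype_coe.hausdorffMeasure_image (Or.inl (Nat.cast_nonneg m)) E

/-- There is a linear isometry between spaces of the same dimension that takes a given vector to a
multiple of another given one. -/
lemma exists_linearIsometryEquiv_apply_eq {V W : Type*} [NormedAddCommGroup V]
    [InnerProductSpace ℝ V] [FiniteDimensional ℝ V] [NormedAddCommGroup W] [InnerProductSpace ℝ W]
    [FiniteDimensional ℝ W] (h : Module.finrank ℝ W = Module.finrank ℝ V) {w : W}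
    {n : V} (hn : n ≠ 0) : ∃ U : W ≃ₗᵢ[ℝ] V, U w = (‖w‖ / ‖n‖) • n := by
  let U₀ : W ≃ₗᵢ[ℝ] V :=
    (stdOrthonormalBasis ℝ W).repr.trans
      ((LinearIsometryEquiv.piLpCongrLeft 2 ℝ ℝ (finCongr h)).trans
        (stdOrthonormalBasis ℝ V).repr.symm)
  have hnorm : ‖U₀ w‖ = ‖(‖w‖ / ‖n‖) • n‖ := by
    rw [LinearIsometryEquiv.norm_map, norm_smul, norm_div, norm_norm, norm_norm,
      div_mul_cancel₀ _ (norm_ne_zero_iff.2 hn)]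
  -- Two vectors of equal norm are exchanged by the reflection in the hyperplane orthogonal to their
  -- difference.
  exact ⟨U₀.trans (ℝ ∙ (U₀ w - (‖w‖ / ‖n‖) • n))ᗮ.reflection, Submodule.reflection_sub hnorm⟩

variable {V W : Type*} [NormedAddCommGroup V] [InnerProductSpace ℝ V] [FiniteDimensional ℝ V]
  [MeasurableSpace V] [BorelSpace V] [NormedAddCommGroup W] [InnerProductSpace ℝ W]
  [FiniteDimensional ℝ W] [MeasurableSpace W] [BorelSpace W]

/-- If a linear isomorphism `A` scales volumes by `c`, then it scales the volumes in the hyperplane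
orthogonal to `n` by `c ‖(A⁻¹)* n‖ / ‖n‖`. -/
lemma hausdorffMeasure_image_hyperplane (A : V ≃ₗ[ℝ] W) {m : ℕ}
    (hm : Module.finrank ℝ V = m + 1) {c : ℝ} (hc : 0 ≤ c)
    (hA : ∀ E : Set V, μH[(m + 1 : ℕ)] (A '' E) = ENNReal.ofReal c * μH[(m + 1 : ℕ)] E)
    {n : V} (hn : n ≠ 0) {w : W} (hw : ∀ x, ⟪A x, w⟫ = ⟪x, n⟫) {E : Set V}
    (hE : ∀ x ∈ E, ⟪x, n⟫ = 0) :
    μH[m] (A '' E) = ENNReal.ofReal (c * (‖w‖ / ‖n‖)) * μH[m] E := by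
  obtain ⟨U, hU⟩ := exists_linearIsometryEquiv_apply_eq A.finrank_eq.symm (w := w) hn
  have hw0 : w ≠ 0 := by
    rintro rfl
    have := hw n
    rw [inner_zero_right, eq_comm, inner_self_eq_zero] at this
    exact hn this
  set k : ℝ := ‖n‖ / ‖w‖ with hk
  have hk0 : 0 < k := div_pos (norm_pos_iff.2 hn) (norm_pos_iff.2 hw0)
  -- After rotating `w` to the direction of `n`, the map is an endomorphism of `V` that preserves `T
  -- = nᗮ` and acts on the line `V ⧸ T` as multiplication by `k = ‖n‖ / ‖w‖`. Hence its determinant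
  -- on `T` is `det M / k`, and `|det M| = c`.
  let M : V →ₗ[ℝ] V := U.toLinearEquiv.toLinearMap ∘ₗ A.toLinearMap
  have hMn : ∀ x, ⟪M x, n⟫ = k * ⟪x, n⟫ := by
    intro x
    have h1 : n = k • U w := by
      rw [hU, smul_smul, hk, div_mul_div_comm, mul_comm, div_self, one_smul]
      exact mul_ne_zero (norm_ne_zero_iff.2 hw0) (norm_ne_zero_iff.2 hn)
    calc ⟪M x, n⟫ = ⟪U (A x), k • U w⟫ := by rw [← h1]; rfl
      _ = k * ⟪x, n⟫ := by rw [inner_smul_right, LinearIsometryEquiv.inner_map_map, hw]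
  have himg : ∀ (r : ℕ) (E : Set V), μH[r] (M '' E) = μH[r] (A '' E) := by
    intro r E
    have : M '' E = U '' (A '' E) := by rw [← image_comp]; rfl
    rw [this, U.isometry.hausdorffMeasure_image (Or.inl (Nat.cast_nonneg r))]
  have hdet : |LinearMap.det M| = c := by
    have : (μH[(m + 1 : ℕ)] : Measure V).IsAddHaarMeasure := by
      rw [← hm]
      infer_instance
    -- In the dimension of the space, Hausdorff measure is a Haar measure; the unit ball, of
    -- positive finite measure, serves to read off the factor.
    have h1 := Measure.addHaar_image_linearMap (μH[(m + 1 : ℕ)]) M (Metric.ball (0 : V) 1)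
    rw [himg, hA] at h1
    have h2 := (ENNReal.mul_left_inj (Metric.measure_ball_pos _ (0 : V) one_pos).ne'
      measure_ball_lt_top.ne).1 h1
    exact ((ENNReal.ofReal_eq_ofReal_iff hc (abs_nonneg _)).1 h2).symm
  let T : Submodule ℝ V := (ℝ ∙ n)ᗮ
  have hmem : ∀ x, x ∈ T ↔ ⟪x, n⟫ = 0 := fun x => by
    rw [real_inner_comm]
    exact Submodule.mem_orthogonal_singleton_iff_inner_right
  have hMT : T ≤ T.comap M := fun x hx => by
    rw [Submodule.mem_comap, hmem, hMn, (hmem x).1 hx, mul_zero]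
  have hTrank : Module.finrank ℝ T = m := by
    have := Submodule.finrank_add_finrank_orthogonal (ℝ ∙ n)
    rw [finrank_span_singleton hn, hm] at this
    change Module.finrank ℝ (ℝ ∙ n)ᗮ = m
    omega
  have hQrank : Module.finrank ℝ (V ⧸ T) = 1 := by
    have := T.finrank_quotient_add_finrank
    omega
  have hQ : T.mapQ T M hMT = k • LinearMap.id := by
    refine Submodule.linearMap_qext _ (LinearMap.ext fun x => ?_)
    change (Submodule.Quotient.mk (M x) : V ⧸ T) = k • Submodule.Quotient.mk x
    rw [← Submodule.Quotient.mk_smul, Submodule.Quotient.eq, hmem, inner_sub_left, hMn,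
      inner_smul_left]
    simp
  let B : T →ₗ[ℝ] T := M.restrict hMT
  have hdetT : |LinearMap.det B| = c * (‖w‖ / ‖n‖) := by
    have h1 : LinearMap.det M = LinearMap.det B * _ := LinearMap.det_eq_det_mul_det T M hMT
    rw [hQ, LinearMap.det_smul, LinearMap.det_id, hQrank, pow_one, mul_one] at h1
    rw [← hdet, h1, abs_mul, abs_of_pos hk0, mul_assoc, hk, div_mul_div_comm, mul_comm ‖w‖,
      div_self, mul_one]
    exact mul_ne_zero (norm_ne_zero_iff.2 hn) (norm_ne_zero_iff.2 hw0)
  have hE' : E = (↑) '' ((↑) ⁻¹' E : Set T) := by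
    ext x
    refine ⟨fun hx => ⟨⟨x, (hmem x).2 (hE x hx)⟩, hx, rfl⟩, ?_⟩
    rintro ⟨y, hy, rfl⟩
    exact hy
  set E' : Set T := (↑) ⁻¹' E
  have hME : M '' ((↑) '' E') = (↑) '' (B '' E') := by
    rw [← image_comp, ← image_comp]
    rfl
  have : (μH[m] : Measure T).IsAddHaarMeasure := by
    rw [← hTrank]
    infer_instance
  rw [← himg, hE', hME, hausdorffMeasure_submodule_image_coe,
    hausdorffMeasure_submodule_image_coe, Measure.addHaar_image_linearMap, hdetT]

end Hausdorff

/-! ### Level sets compared with their tangent spaces. -/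

section LevelSets

variable {V F W : Type*} [NormedAddCommGroup V] [InnerProductSpace ℝ V] [FiniteDimensional ℝ V]
  [NormedAddCommGroup F] [NormedSpace ℝ F] [NormedAddCommGroup W] [NormedSpace ℝ W]
  {Φ : V → F} {Φ' : V →L[ℝ] F}

/-- The orthogonal projection to the kernel of `Φ'`. -/
noncomputable def kerProj (Φ' : V →L[ℝ] F) : V →L[ℝ] V :=
  (LinearMap.ker (Φ' : V →ₗ[ℝ] F)).starProjection

lemma apply_kerProj (x : V) : Φ' (kerProj Φ' x) = 0 :=
  ((LinearMap.ker (Φ' : V →ₗ[ℝ] F)).starProjection_apply_mem x)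

lemma norm_kerProj_le (x : V) : ‖kerProj Φ' x‖ ≤ ‖x‖ :=
  Submodule.norm_starProjection_apply_le _ x

/-- `Φ'` is injective on the orthogonal complement of its kernel, hence bounded below there by
finite dimensionality. -/
lemma exists_norm_sub_kerProj_le (Φ' : V →L[ℝ] F) :
    ∃ C > 0, ∀ x, ‖x - kerProj Φ' x‖ ≤ C * ‖Φ' x‖ := by
  set T := LinearMap.ker (Φ' : V →ₗ[ℝ] F)
  have hker : LinearMap.ker ((Φ' : V →ₗ[ℝ] F) ∘ₗ Tᗮ.subtype) = ⊥ := by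
    rw [LinearMap.ker_eq_bot']
    intro x hx
    have h1 : (x : V) ∈ T ⊓ Tᗮ := ⟨hx, x.2⟩
    rw [Submodule.inf_orthogonal_eq_bot] at h1
    exact Subtype.ext h1
  obtain ⟨C, hC, h⟩ := LinearMap.exists_antilipschitzWith _ hker
  refine ⟨C, by exact_mod_cast hC, fun x => ?_⟩
  have hx : x - kerProj Φ' x ∈ Tᗮ := T.sub_starProjection_mem_orthogonal x
  have h1 := h.le_mul_dist ⟨_, hx⟩ 0
  rw [dist_zero_right, map_zero, dist_zero_right] at h1
  have h2 : ((Φ' : V →ₗ[ℝ] F) ∘ₗ Tᗮ.subtype) ⟨_, hx⟩ = Φ' x := by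
    change Φ' (x - kerProj Φ' x) = Φ' x
    rw [map_sub, apply_kerProj, sub_zero]
  rwa [h2] at h1

/-- Near a point, a level set lies close to its tangent space. -/
lemma eventually_norm_sub_kerProj_le (hΦ : HasStrictFDerivAt Φ Φ' 0) {ε : ℝ} (hε : 0 < ε) :
    ∀ᶠ z : V × V in 𝓝 (0, 0), Φ z.1 = 0 → Φ z.2 = 0 →
      ‖z.1 - z.2 - kerProj Φ' (z.1 - z.2)‖ ≤ ε * ‖z.1 - z.2‖ := by
  obtain ⟨C, hC, h⟩ := exists_norm_sub_kerProj_le Φ'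
  filter_upwards [hΦ.isLittleO.def (div_pos hε hC)] with z hz h1 h2
  rw [h1, h2, sub_zero, zero_sub, norm_neg] at hz
  calc _ ≤ C * ‖Φ' (z.1 - z.2)‖ := h _
    _ ≤ C * (ε / C * ‖z.1 - z.2‖) := by gcongr
    _ = ε * ‖z.1 - z.2‖ := by field_simp

/-- On a level set of `Φ` near `0`, the projection to the tangent space is almost isometric, and `G`
is almost isometric to the composition of its derivative with the projection. -/
lemma eventually_dist_le (hΦ : HasStrictFDerivAt Φ Φ' 0) {G : V → W} {G' : V →L[ℝ] W}
    (hG : HasStrictFDerivAt G G' 0) {c : ℝ} (hc : 0 < c) (hG' : ∀ x, c * ‖x‖ ≤ ‖G' x‖)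
    {K : ℝ} (hK : 1 < K) :
    ∀ᶠ z : V × V in 𝓝 (0, 0), Φ z.1 = 0 → Φ z.2 = 0 →
      dist z.1 z.2 ≤ K * dist (kerProj Φ' z.1) (kerProj Φ' z.2) ∧
      dist (G z.1) (G z.2) ≤ K * dist (G' (kerProj Φ' z.1)) (G' (kerProj Φ' z.2)) ∧
      dist (G' (kerProj Φ' z.1)) (G' (kerProj Φ' z.2)) ≤ K * dist (G z.1) (G z.2) := by
  -- The first condition yields `‖w‖ ≤ K ‖u‖` for a chord `w` with projection `u`. The second makes
  -- the error `G z.1 - G z.2 - G' u` at most `(1 - K⁻¹) ‖G' u‖`.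
  obtain ⟨ε, hε, hε1, hε2⟩ : ∃ ε > 0, 1 ≤ K * (1 - ε) ∧
      ε * (1 + ‖G'‖) * K ≤ (1 - K⁻¹) * c := by
    have hK' : 0 < 1 - K⁻¹ := sub_pos.2 (inv_lt_one_of_one_lt₀ hK)
    have h1 : ∀ᶠ ε : ℝ in 𝓝[>] 0, 1 < K * (1 - ε) := by
      have : Continuous fun ε : ℝ => K * (1 - ε) := by fun_prop
      exact (this.tendsto 0).eventually (lt_mem_nhds (by simpa using hK)) |>.filter_mono
        nhdsWithin_le_nhds
    have h2 : ∀ᶠ ε : ℝ in 𝓝[>] 0, ε * (1 + ‖G'‖) * K < (1 - K⁻¹) * c := by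
      have : Continuous fun ε : ℝ => ε * (1 + ‖G'‖) * K := by fun_prop
      exact (this.tendsto 0).eventually (gt_mem_nhds (by simpa using mul_pos hK' hc)) |>.filter_mono
        nhdsWithin_le_nhds
    obtain ⟨ε, ⟨h3, h4⟩, h5⟩ := ((h1.and h2).and self_mem_nhdsWithin).exists
    exact ⟨ε, h5, h3.le, h4.le⟩
  filter_upwards [eventually_norm_sub_kerProj_le hΦ hε, hG.isLittleO.def hε] with z hz1 hz2 h1 h2
  replace hz1 := hz1 h1 h2
  set w := z.1 - z.2 with hw
  set u := kerProj Φ' w with hu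
  have hd1 : dist (kerProj Φ' z.1) (kerProj Φ' z.2) = ‖u‖ := by rw [dist_eq_norm, ← map_sub]
  have hd2 : dist (G' (kerProj Φ' z.1)) (G' (kerProj Φ' z.2)) = ‖G' u‖ := by
    rw [dist_eq_norm, ← map_sub, ← map_sub]
  rw [hd1, hd2, dist_eq_norm, dist_eq_norm, ← hw]
  have h3 : (1 - ε) * ‖w‖ ≤ ‖u‖ := by
    have := norm_sub_norm_le w u
    linarith
  have h4 : ‖w‖ ≤ K * ‖u‖ := by
    calc ‖w‖ ≤ K * (1 - ε) * ‖w‖ := le_mul_of_one_le_left (norm_nonneg _) hε1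
      _ = K * ((1 - ε) * ‖w‖) := by ring
      _ ≤ K * ‖u‖ := by gcongr
  have h5 : ‖G z.1 - G z.2 - G' u‖ ≤ (1 - K⁻¹) * ‖G' u‖ := by
    have e : G z.1 - G z.2 - G' u = (G z.1 - G z.2 - G' w) + G' (w - u) := by
      rw [map_sub G' w u]
      abel
    calc _ ≤ ‖G z.1 - G z.2 - G' w‖ + ‖G' (w - u)‖ := e ▸ norm_add_le _ _
      _ ≤ ε * ‖w‖ + ‖G'‖ * (ε * ‖w‖) := by
          gcongr
          exact (G'.le_opNorm _).trans (by gcongr)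
      _ = ε * (1 + ‖G'‖) * ‖w‖ := by ring
      _ ≤ ε * (1 + ‖G'‖) * (K * ‖u‖) := by gcongr
      _ = ε * (1 + ‖G'‖) * K * ‖u‖ := by ring
      _ ≤ (1 - K⁻¹) * c * ‖u‖ := by gcongr
      _ = (1 - K⁻¹) * (c * ‖u‖) := by ring
      _ ≤ (1 - K⁻¹) * ‖G' u‖ := by
          gcongr
          · exact sub_nonneg.2 (inv_le_one_of_one_le₀ hK.le)
          · exact hG' u
  -- The upper bound obtained is `2 - K⁻¹`, which is at most `K`.
  have hKi : K + K⁻¹ ≥ 2 := by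
    have : K * K⁻¹ = 1 := mul_inv_cancel₀ (by positivity)
    have : 0 < K⁻¹ := by positivity
    nlinarith [sq_nonneg (K - 1)]
  refine ⟨h4, ?_, ?_⟩
  · have := norm_le_norm_add_norm_sub' (G z.1 - G z.2) (G' u)
    nlinarith [norm_nonneg (G' u)]
  · have h6 := norm_le_norm_add_norm_sub (G z.1 - G z.2) (G' u)
    have h7 : K⁻¹ * ‖G' u‖ ≤ ‖G z.1 - G z.2‖ := by linarith
    calc ‖G' u‖ = K * (K⁻¹ * ‖G' u‖) := by field_simp
      _ ≤ K * ‖G z.1 - G z.2‖ := by gcongr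

/-- The projection of a neighbourhood of `0` in a level set contains a neighbourhood of `0` in the
tangent space. -/
lemma exists_ball_subset_kerProj_image [CompleteSpace F] (hΦ : HasStrictFDerivAt Φ Φ' 0)
    (hΦ0 : Φ 0 = 0) (hsurj : Function.Surjective Φ') {U : Set V} (hU : U ∈ 𝓝 0) :
    ∃ r > 0, ∀ u, Φ' u = 0 → ‖u‖ < r → u ∈ kerProj Φ' '' {p | p ∈ U ∧ Φ p = 0} := by
  let T := LinearMap.ker (Φ' : V →ₗ[ℝ] F)
  -- Together, `Φ` and the projection to its tangent space form a submersion at `0`, hence an open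
  -- map there; the values `(0, τ)` with small `τ` are thus attained in `U`.
  have h1 : HasStrictFDerivAt (fun p => (Φ p, T.orthogonalProjectionOnto p))
      (Φ'.prod T.orthogonalProjectionOnto) 0 :=
    hΦ.prodMk T.orthogonalProjectionOnto.hasStrictFDerivAt
  have h2 : (Φ'.prod T.orthogonalProjectionOnto).range = ⊤ := by
    rw [LinearMap.range_eq_top]
    rintro ⟨a, τ⟩
    obtain ⟨x, hx⟩ := hsurj a
    refine ⟨x - T.orthogonalProjectionOnto x + τ, Prod.ext ?_ ?_⟩
    · change Φ' (x - T.orthogonalProjectionOnto x + τ) = a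
      have e1 : Φ' (T.orthogonalProjectionOnto x) = 0 := (T.orthogonalProjectionOnto x).2
      have e2 : Φ' (τ : V) = 0 := τ.2
      rw [map_add, map_sub, e1, e2, hx, sub_zero, add_zero]
    · change T.orthogonalProjectionOnto (x - T.orthogonalProjectionOnto x + τ) = τ
      have e1 : ∀ u : T, T.orthogonalProjectionOnto (u : V) = u :=
        T.orthogonalProjectionOnto_mem_subspace_eq_self
      rw [map_add, map_sub, e1, e1, sub_self, zero_add]
  have h3 := h1.map_nhds_eq_of_surj h2
  have h4 := h3 ▸ image_mem_map hU
  rw [hΦ0, map_zero] at h4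
  have h5 : Tendsto (fun τ : T => ((0 : F), τ)) (𝓝 0) (𝓝 (0, 0)) := by
    have : Continuous fun τ : T => ((0 : F), τ) := by fun_prop
    exact this.tendsto 0
  obtain ⟨r, hr, h6⟩ := Metric.mem_nhds_iff.1 (h5 h4)
  refine ⟨r, hr, fun u hu hur => ?_⟩
  obtain ⟨p, hpU, hp⟩ := h6 (show (⟨u, hu⟩ : T) ∈ Metric.ball 0 r by simpa using hur)
  rw [Prod.mk.injEq] at hp
  exact ⟨p, ⟨hpU, hp.1⟩, congrArg Subtype.val hp.2⟩

end LevelSets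

/-! ### Volume of projected level sets and the squeeze of volume ratios. -/

section LevelSetVolume

variable {V F : Type*} [NormedAddCommGroup V] [InnerProductSpace ℝ V] [FiniteDimensional ℝ V]
  [MeasurableSpace V] [BorelSpace V] [NormedAddCommGroup F] [NormedSpace ℝ F]
  {Φ : V → F} {Φ' : V →L[ℝ] F} {m : ℕ}

lemma kerProj_image_eq {V F : Type*} [NormedAddCommGroup V] [InnerProductSpace ℝ V]
    [FiniteDimensional ℝ V] [NormedAddCommGroup F] [NormedSpace ℝ F] {Φ' : V →L[ℝ] F} (S : Set V) :
    ∃ E : Set (LinearMap.ker (Φ' : V →ₗ[ℝ] F)), kerProj Φ' '' S = (↑) '' E :=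
  ⟨(LinearMap.ker (Φ' : V →ₗ[ℝ] F)).orthogonalProjectionOnto '' S, by
    rw [← image_comp]
    rfl⟩

lemma hausdorffMeasure_kerProj_image_ne_top
    (hm : Module.finrank ℝ (LinearMap.ker (Φ' : V →ₗ[ℝ] F)) = m) {S : Set V} {r : ℝ}
    (hS : ∀ p ∈ S, ‖p‖ < r) : μH[m] (kerProj Φ' '' S) ≠ ⊤ := by
  obtain ⟨E, hE⟩ := kerProj_image_eq (Φ' := Φ') S
  have hEr : E ⊆ Metric.ball 0 r := by
    intro u hu
    have : (u : V) ∈ kerProj Φ' '' S := hE ▸ mem_image_of_mem _ hu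
    obtain ⟨p, hp, hpu⟩ := this
    rw [mem_ball_zero_iff, Submodule.coe_norm, ← hpu]
    exact (norm_kerProj_le p).trans_lt (hS p hp)
  have : (μH[m] : Measure (LinearMap.ker (Φ' : V →ₗ[ℝ] F))).IsAddHaarMeasure := by
    rw [← hm]
    infer_instance
  rw [hE, hausdorffMeasure_submodule_image_coe]
  exact ((measure_mono hEr).trans_lt measure_ball_lt_top).ne

lemma hausdorffMeasure_kerProj_image_ne_zero [CompleteSpace F]
    (hm : Module.finrank ℝ (LinearMap.ker (Φ' : V →ₗ[ℝ] F)) = m) (hΦ : HasStrictFDerivAt Φ Φ' 0)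
    (hΦ0 : Φ 0 = 0) (hsurj : Function.Surjective Φ') {U : Set V} (hU : U ∈ 𝓝 0) :
    μH[m] (kerProj Φ' '' {p | p ∈ U ∧ Φ p = 0}) ≠ 0 := by
  obtain ⟨r, hr, h⟩ := exists_ball_subset_kerProj_image hΦ hΦ0 hsurj hU
  have hsub : (↑) '' Metric.ball (0 : LinearMap.ker (Φ' : V →ₗ[ℝ] F)) r ⊆
      kerProj Φ' '' {p | p ∈ U ∧ Φ p = 0} := by
    rintro _ ⟨u, hu, rfl⟩
    exact h u u.2 (by simpa using hu)
  have : (μH[m] : Measure (LinearMap.ker (Φ' : V →ₗ[ℝ] F))).IsAddHaarMeasure := by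
    rw [← hm]
    infer_instance
  have h1 := measure_mono (μ := μH[m]) hsub
  rw [hausdorffMeasure_submodule_image_coe] at h1
  exact ((Metric.measure_ball_pos _ _ hr).trans_le h1).ne'

/-- Here `a`, `b`, `g` stand for the volumes of a set, of its tangential projection and of its image
under the flow; `ρ` is the linear expansion factor and `κ` the distortion. -/
lemma le_div_and_div_le_of_comparison {a b g κ ρ : ℝ≥0∞} (hκ0 : κ ≠ 0) (hκ : κ ≠ ⊤) (ha : a ≠ 0)
    (hb : b ≠ ⊤) (h1 : a ≤ κ * b) (h2 : b ≤ a) (h3 : g ≤ κ * (ρ * b)) (h4 : ρ * b ≤ κ * g) :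
    ρ * κ⁻¹ * κ⁻¹ ≤ g / a ∧ g / a ≤ ρ * κ := by
  have hatop : a ≠ ⊤ := (h1.trans_lt (ENNReal.mul_lt_top hκ.lt_top hb.lt_top)).ne
  have hκ1 : κ⁻¹ * κ = 1 := ENNReal.inv_mul_cancel hκ0 hκ
  constructor
  · rw [ENNReal.le_div_iff_mul_le (Or.inl ha) (Or.inl hatop)]
    calc ρ * κ⁻¹ * κ⁻¹ * a ≤ ρ * κ⁻¹ * κ⁻¹ * (κ * b) := by gcongr
      _ = κ⁻¹ * (ρ * b) * (κ⁻¹ * κ) := by ring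
      _ ≤ κ⁻¹ * (κ * g) * (κ⁻¹ * κ) := by gcongr
      _ = g := by rw [hκ1, mul_one, ← mul_assoc, hκ1, one_mul]
  · refine ENNReal.div_le_of_le_mul ?_
    calc g ≤ κ * (ρ * b) := h3
      _ ≤ κ * (ρ * a) := by gcongr
      _ = ρ * κ * a := by ring

/-- A quantity that is eventually within factors near `1` of `ρ` tends to `ρ`. -/
lemma tendsto_of_forall_eventually_mem_Icc {ι : Type*} {l : Filter ι} {u : ι → ℝ≥0∞} {ρ : ℝ≥0∞}
    (hρ : ρ ≠ ⊤) (m : ℕ)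
    (h : ∀ K : ℝ, 1 < K → ∀ᶠ i in l, ρ * (ENNReal.ofReal (K ^ m))⁻¹ * (ENNReal.ofReal (K ^ m))⁻¹ ≤
      u i ∧ u i ≤ ρ * ENNReal.ofReal (K ^ m)) : Tendsto u l (𝓝 ρ) := by
  have hK : Tendsto (fun K : ℝ => ENNReal.ofReal (K ^ m)) (𝓝[>] 1) (𝓝 1) := by
    have : Continuous fun K : ℝ => ENNReal.ofReal (K ^ m) :=
      ENNReal.continuous_ofReal.comp (continuous_pow m)
    exact (this.tendsto' 1 1 (by simp)).mono_left nhdsWithin_le_nhds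
  have hup : Tendsto (fun K : ℝ => ρ * ENNReal.ofReal (K ^ m)) (𝓝[>] 1) (𝓝 ρ) := by
    simpa using ENNReal.Tendsto.const_mul hK (Or.inr hρ)
  have hKi : Tendsto (fun K : ℝ => (ENNReal.ofReal (K ^ m))⁻¹) (𝓝[>] 1) (𝓝 1) := by
    simpa using hK.inv
  have hlow : Tendsto (fun K : ℝ => ρ * (ENNReal.ofReal (K ^ m))⁻¹ * (ENNReal.ofReal (K ^ m))⁻¹)
      (𝓝[>] 1) (𝓝 ρ) := by
    have h1 : Tendsto (fun K : ℝ => ρ * (ENNReal.ofReal (K ^ m))⁻¹) (𝓝[>] 1) (𝓝 ρ) := by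
      simpa using ENNReal.Tendsto.const_mul hKi (Or.inr hρ)
    simpa using ENNReal.Tendsto.mul h1 (Or.inr ENNReal.one_ne_top) hKi (Or.inr hρ)
  refine tendsto_order.2 ⟨fun a ha => ?_, fun a ha => ?_⟩
  · obtain ⟨K, hK1, hK2⟩ := ((hlow.eventually (lt_mem_nhds ha)).and self_mem_nhdsWithin).exists
    exact (h K hK2).mono fun i hi => hK1.trans_le hi.1
  · obtain ⟨K, hK1, hK2⟩ := ((hup.eventually (gt_mem_nhds ha)).and self_mem_nhdsWithin).exists
    exact (h K hK2).mono fun i hi => hi.2.trans_lt hK1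

end LevelSetVolume

/-! ### Volume expansion of hypersurfaces by the flow. -/

section Volume

variable {d : ℕ} {L : AddSubgroup (Euc d)} {D : Set (Euc d ⧸ L)} {t : ℝ} {y y' : Phase L}
  {G H : Vec d → Vec d}

lemma finrank_vec (d : ℕ) : Module.finrank ℝ (Vec d) = 2 * d := by
  rw [(WithLp.linearEquiv 2 ℝ (Euc d × Euc d)).finrank_eq, Module.finrank_prod, finrank_euclideanSpace,
    Fintype.card_fin, two_mul]

lemma finrank_orthogonal_singleton_add_one {V : Type*} [NormedAddCommGroup V]
    [InnerProductSpace ℝ V] [FiniteDimensional ℝ V] {n : V} (hn : n ≠ 0) :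
    Module.finrank ℝ (ℝ ∙ n)ᗮ + 1 = Module.finrank ℝ V := by
  have h := Submodule.finrank_add_finrank_orthogonal (ℝ ∙ n)
  rw [finrank_span_singleton hn] at h
  omega

lemma inner_vec_mk_zero (x : Vec d) (v : Euc d) :
    ⟪x, (WithLp.toLp 2 (0, v) : Vec d)⟫ = ⟪x.snd, v⟫ := by
  rw [WithLp.prod_inner_apply]
  simp

lemma finrank_tangentSpace {m : ℕ} (hm : 2 * d = m + 1) (hv : y.snd ≠ 0) :
    Module.finrank ℝ (tangentSpace y) = m := by
  have h1 : tangentSpace y = (ℝ ∙ (WithLp.toLp 2 (0, y.snd) : Vec d))ᗮ := by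
    ext x
    rw [Submodule.mem_orthogonal_singleton_iff_inner_left, inner_vec_mk_zero]
    rfl
  have h2 : (WithLp.toLp 2 (0, y.snd) : Vec d) ≠ 0 := fun h0 =>
    hv (congrArg (fun p : Vec d => p.snd) h0)
  have h3 : Module.finrank ℝ (tangentSpace y) + 1 = 2 * d := by
    rw [h1, ← finrank_vec d]
    exact finrank_orthogonal_singleton_add_one h2
  omega

/-- The derivative of the flow preserves the volume in the tangent spaces. -/
lemma IsFlowChart.hausdorffMeasure_image_tangentSpace (h : IsFlowChart D t y y' G H) {m : ℕ}
    (hm : 2 * d = m + 1) (hv : y.snd ≠ 0) (hvv : ‖y'.snd‖ = ‖y.snd‖) (E : Set (tangentSpace y)) :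
    μH[m] (h.tangentEquiv '' E) = μH[m] E := by
  let A : Vec d ≃ₗ[ℝ] Vec d :=
    { (fderiv ℝ G 0 : Vec d →ₗ[ℝ] Vec d) with
      invFun := fderiv ℝ H 0
      left_inv := h.fderiv_inv_apply
      right_inv := h.symm.fderiv_inv_apply }
  have hrank : Module.finrank ℝ (Vec d) = m + 1 := by rw [finrank_vec, hm]
  have hA : ∀ E : Set (Vec d), μH[(m + 1 : ℕ)] (A '' E) =
      ENNReal.ofReal 1 * μH[(m + 1 : ℕ)] E := by
    intro E
    have : (μH[(m + 1 : ℕ)] : Measure (Vec d)).IsAddHaarMeasure := by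
      rw [← hrank]
      infer_instance
    have h1 := Measure.addHaar_image_linearMap (μH[(m + 1 : ℕ)])
      (fderiv ℝ G 0 : Vec d →ₗ[ℝ] Vec d) E
    rwa [h.abs_det] at h1
  have hn : (WithLp.toLp 2 (0, y.snd) : Vec d) ≠ 0 := fun h0 =>
    hv (congrArg (fun p : Vec d => p.snd) h0)
  -- The tangent space is the hyperplane orthogonal to `(0, v)`. Conservation of speed says that
  -- `(0, v)` and `(0, v')` correspond under the derivative, and their norms agree.
  have h2 := hausdorffMeasure_image_hyperplane A hrank zero_le_one hA hn
    (w := (WithLp.toLp 2 (0, y'.snd) : Vec d))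
    (fun x => by
      rw [inner_vec_mk_zero, inner_vec_mk_zero]
      exact h.inner_fderiv_snd x)
    (E := (↑) '' E) (by
      rintro _ ⟨x, -, rfl⟩
      rw [inner_vec_mk_zero]
      exact x.2)
  have h3 : ‖(WithLp.toLp 2 (0, y'.snd) : Vec d)‖ / ‖(WithLp.toLp 2 (0, y.snd) : Vec d)‖ = 1 := by
    rw [WithLp.norm_toLp_snd, WithLp.norm_toLp_snd, hvv, div_self (norm_ne_zero_iff.2 hv)]
  have h4 : A '' ((↑) '' E) = (↑) '' (h.tangentEquiv '' E) := by
    rw [← image_comp, ← image_comp]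
    rfl
  rwa [h3, mul_one, ENNReal.ofReal_one, one_mul, h4, hausdorffMeasure_submodule_image_coe,
    hausdorffMeasure_submodule_image_coe] at h2

lemma IsFlowChart.hausdorffMeasure_image_hypersurface (h : IsFlowChart D t y y' G H) {m : ℕ}
    (hm : 2 * d = m + 2) (hv : y.snd ≠ 0) (hvv : ‖y'.snd‖ = ‖y.snd‖) {n : tangentSpace y}
    (hn : n ≠ 0) {w : tangentSpace y'} (hw : ∀ ξ, ⟪h.tangentEquiv ξ, w⟫ = ⟪ξ, n⟫)
    {E : Set (Vec d)} (hE : ∀ x ∈ E, ∃ ξ : tangentSpace y, (ξ : Vec d) = x ∧ ⟪ξ, n⟫ = 0) :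
    μH[m] (fderiv ℝ G 0 '' E) = ENNReal.ofReal (‖w‖ / ‖n‖) * μH[m] E := by
  have h1 := hausdorffMeasure_image_hyperplane (V := tangentSpace y) (W := tangentSpace y')
    h.tangentEquiv
    (finrank_tangentSpace (m := m + 1) hm hv) zero_le_one
    (fun E => by
      rw [h.hausdorffMeasure_image_tangentSpace hm hv hvv, ENNReal.ofReal_one, one_mul]) hn hw
    (E := (↑) ⁻¹' E) (by
      intro x hx
      obtain ⟨ξ, hξ, hξn⟩ := hE x hx
      rwa [← Subtype.ext hξ])
  have h2 : E = (↑) '' ((↑) ⁻¹' E : Set (tangentSpace y)) := by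
    ext x
    refine ⟨fun hx => ?_, ?_⟩
    · obtain ⟨ξ, rfl, -⟩ := hE x hx
      exact ⟨ξ, hx, rfl⟩
    · rintro ⟨ξ, hξ, rfl⟩
      exact hξ
  have h3 : fderiv ℝ G 0 '' E =
      (↑) '' (h.tangentEquiv '' ((↑) ⁻¹' E : Set (tangentSpace y))) := by
    rw [← image_comp]
    conv_lhs => rw [h2, ← image_comp]
    rfl
  rw [h3, hausdorffMeasure_submodule_image_coe, h1, one_mul]
  conv_rhs => rw [h2, hausdorffMeasure_submodule_image_coe]

/-- A hypersurface of the unit tangent bundle is in flat coordinates a regular level set of a map to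
the plane. -/
lemma IsHypersurfaceAt.exists_hasStrictFDerivAt {J : Set (Phase L)}
    {T : Submodule ℝ (tangentSpace y)} (hT : IsHypersurfaceAt J y T) (hJ : J ⊆ phaseSpace D)
    (hv : ‖y.snd‖ = 1) : ∃ (Φ : Vec d → ℝ × ℝ) (Φ' : Vec d →L[ℝ] ℝ × ℝ), HasStrictFDerivAt Φ Φ' 0 ∧
      Φ 0 = 0 ∧ Function.Surjective Φ' ∧
      (∀ x, Φ' x = 0 → ∃ ξ : tangentSpace y, (ξ : Vec d) = x ∧ ξ ∈ T) ∧
      ∀ᶠ p in 𝓝 (0 : Vec d), Φ p = 0 ↔ y.shift p ∈ J := by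
  obtain ⟨k, hk, hk0, hkJ, ⟨ξ, hξ⟩, hkT⟩ := hT
  have h1 : HasStrictFDerivAt (fun p : Vec d => y.snd + p.snd) (WithLp.sndL 2 ℝ (Euc d) (Euc d)) 0 :=
    (WithLp.sndL 2 ℝ (Euc d) (Euc d)).hasStrictFDerivAt.const_add y.snd
  have h2 := ((hasStrictFDerivAt_norm_sq _).comp (0 : Vec d) h1).sub_const 1
  rw [WithLp.zero_snd, add_zero] at h2
  have h3 := (hk.hasStrictFDerivAt (by norm_num)).prodMk h2
  have happ : ∀ x : Vec d, (((2 • innerSL ℝ y.snd) ∘SL WithLp.sndL 2 ℝ (Euc d) (Euc d) :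
      Vec d →L[ℝ] ℝ)) x = 2 * ⟪y.snd, x.snd⟫ := by
    intro x
    rw [two_mul, two_smul]
    rfl
  refine ⟨_, _, h3, ?_, ?_, ?_, ?_⟩
  · simp [hk0, hv]
  · rintro ⟨a, b⟩
    set n : Vec d := WithLp.toLp 2 (0, y.snd) with hn
    have hn1 : ⟪y.snd, n.snd⟫ = (1 : ℝ) := by
      change ⟪y.snd, y.snd⟫ = (1 : ℝ)
      rw [real_inner_self_eq_norm_sq, hv, one_pow]
    have hξ1 : ⟪y.snd, (ξ : Vec d).snd⟫ = (0 : ℝ) := by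
      rw [real_inner_comm]
      exact ξ.2
    -- The radial vector `n = (0, v)` changes the squared speed at rate `2`, which gives `b / 2`;
    -- the tangent vector `ξ` does not change it and corrects the first component.
    refine ⟨((a - b / 2 * fderiv ℝ k 0 n) / fderiv ℝ k 0 ξ) • (ξ : Vec d) + (b / 2) • n,
      Prod.ext ?_ ?_⟩
    · rw [ContinuousLinearMap.prod_apply, map_add, map_smul, map_smul, smul_eq_mul, smul_eq_mul]
      field_simp
      ring
    · rw [ContinuousLinearMap.prod_apply, happ, WithLp.add_snd, WithLp.smul_snd, WithLp.smul_snd,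
        inner_add_right, inner_smul_right, inner_smul_right, hξ1, hn1]
      ring
  · intro x hx
    rw [ContinuousLinearMap.prod_apply, Prod.mk_eq_zero, happ] at hx
    have hx2 : ⟪x.snd, y.snd⟫ = (0 : ℝ) := by
      rw [real_inner_comm]
      linarith [hx.2]
    exact ⟨⟨x, hx2⟩, rfl, (hkT _).2 hx.1⟩
  · filter_upwards [eventually_nhdsWithin_iff.1 hkJ] with p hp
    rw [Prod.mk_eq_zero]
    constructor
    · rintro ⟨h4, h5⟩
      refine (hp ?_).2 h4
      exact (pow_eq_one_iff_of_nonneg (norm_nonneg _) two_ne_zero).1 (sub_eq_zero.1 h5)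
    · intro h4
      have h5 : ‖y.snd + p.snd‖ = 1 := (hJ h4).2
      exact ⟨(hp h5).1 h4, by rw [h5]; norm_num⟩

lemma hypersurfaceVolume_eq [DiscreteTopology L] {m : ℕ} (hm : 2 * d = m + 2)
    (A : Set (Phase L)) : hypersurfaceVolume A = μH[m] A := by
  have : 2 * (d : ℝ) - 2 = m := by
    have : (2 * d : ℝ) = m + 2 := by exact_mod_cast hm
    linarith
  rw [hypersurfaceVolume, this]

lemma exists_le_norm_apply_of_leftInverse {V : Type*} [NormedAddCommGroup V] [NormedSpace ℝ V]
    {A B : V →L[ℝ] V} (h : ∀ x, B (A x) = x) : ∃ c > 0, ∀ x, c * ‖x‖ ≤ ‖A x‖ := by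
  refine ⟨(‖B‖ + 1)⁻¹, by positivity, fun x => ?_⟩
  rw [inv_mul_le_iff₀ (by positivity)]
  calc ‖x‖ = ‖B (A x)‖ := by rw [h]
    _ ≤ ‖B‖ * ‖A x‖ := B.le_opNorm _
    _ ≤ (‖B‖ + 1) * ‖A x‖ := by gcongr; linarith

lemma IsFlowChart.expandsVolumeAt [DiscreteTopology L] (h : IsFlowChart D t y y' G H)
    (hv : ‖y.snd‖ = 1) (hv' : ‖y'.snd‖ = 1) {J : Set (Phase L)} (hJ : J ⊆ phaseSpace D)
    {T : Submodule ℝ (tangentSpace y)} (hT : IsHypersurfaceAt J y T) {n : tangentSpace y}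
    (hn : IsNormalVector T n) {w : tangentSpace y'}
    (hw : ∀ ξ, ⟪h.tangentEquiv ξ, w⟫ = ⟪ξ, n⟫) :
    ExpandsVolumeAt (flow D t) J y (‖w‖ / ‖n‖) := by
  have hv0 : y.snd ≠ 0 := norm_ne_zero_iff.1 (by rw [hv]; exact one_ne_zero)
  -- A unit velocity exists only if `d > 0`, so the dimension `2d - 2` of `J` is a natural number.
  obtain ⟨m, hm⟩ : ∃ m, 2 * d = m + 2 := by
    rcases d with _ | d
    · exact absurd (Subsingleton.elim _ _) hv0
    · exact ⟨2 * d, by ring⟩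
  obtain ⟨Φ, Φ', hΦ, hΦ0, hsurj, hker, hΦJ⟩ := hT.exists_hasStrictFDerivAt hJ hv
  have hrank : Module.finrank ℝ (LinearMap.ker (Φ' : Vec d →ₗ[ℝ] ℝ × ℝ)) = m := by
    have h1 := LinearMap.finrank_range_add_finrank_ker (Φ' : Vec d →ₗ[ℝ] ℝ × ℝ)
    rw [LinearMap.range_eq_top.2 hsurj, finrank_top, Module.finrank_prod, Module.finrank_self,
      finrank_vec] at h1
    omega
  obtain ⟨r, hr, hdist⟩ := exists_dist_phase_shift_eq L
  set P := kerProj Φ' with hP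
  have hball : ∀ᶠ p in 𝓝 (0 : Vec d), ‖p‖ < r := by
    filter_upwards [Metric.ball_mem_nhds (0 : Vec d) hr] with p hp using by simpa using hp
  have hdistP : ∀ p p' : Vec d, dist (P p) (P p') ≤ dist p p' := by
    intro p p'
    rw [dist_eq_norm, dist_eq_norm, ← map_sub]
    exact norm_kerProj_le _
  constructor
  · intro s hs
    rw [hypersurfaceVolume_eq hm]
    have hU := ((tendsto_phase_shift y).eventually (Metric.ball_mem_nhds y hs)).and
      (hΦJ.and hball)
    set S := {p | p ∈ {p | y.shift p ∈ Metric.ball y s ∧ (Φ p = 0 ↔ y.shift p ∈ J) ∧ ‖p‖ < r} ∧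
      Φ p = 0} with hS
    have h1 : μH[m] (P '' S) ≠ 0 := hausdorffMeasure_kerProj_image_ne_zero hrank hΦ hΦ0 hsurj hU
    have h2 := hausdorffMeasure_image_le_of_dist_le (S := S) (a := y.shift) (b := P) zero_le_one
      (fun p hp p' hp' => by
        rw [hdist y p p' hp.1.2.2 hp'.1.2.2, one_mul]
        exact hdistP p p') m
    rw [one_pow, ENNReal.ofReal_one, one_mul] at h2
    have h3 : y.shift '' S ⊆ J ∩ Metric.ball y s := by
      rintro _ ⟨p, hp, rfl⟩
      exact ⟨hp.1.2.1.1 hp.2, hp.1.1⟩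
    exact fun h0 => h1 (le_zero_iff.1 ((h2.trans (measure_mono h3)).trans_eq h0))
  · refine tendsto_of_forall_eventually_mem_Icc ENNReal.ofReal_ne_top m fun K hK => ?_
    obtain ⟨c, hc, hcG⟩ := exists_le_norm_apply_of_leftInverse h.fderiv_inv_apply
    have hcomp := eventually_dist_le hΦ (h.contDiffAt.hasStrictFDerivAt (by norm_num)) hc hcG hK
    rw [nhds_prod_eq] at hcomp
    obtain ⟨U, hU, hcompU⟩ := Filter.mem_prod_self_iff.1 hcomp
    set N := {p | p ∈ U ∧ ‖p‖ < r ∧ ‖G p‖ < r ∧ (Φ p = 0 ↔ y.shift p ∈ J) ∧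
      flow D t (y.shift p) = y'.shift (G p)} with hN
    have hNmem : N ∈ 𝓝 0 := by
      filter_upwards [hU, hball, h.tendsto.eventually hball, hΦJ, h.flow_eq] with p h1 h2 h3 h4 h5
      exact ⟨h1, h2, h3, h4, h5⟩
    have hNy : y.shift '' N ∩ J ∈ 𝓝[J] y := by
      refine inter_mem (mem_nhdsWithin_of_mem_nhds ?_) self_mem_nhdsWithin
      rw [← map_phase_shift_nhds]
      exact image_mem_map hNmem
    rw [eventually_inf_principal]
    refine eventually_smallSets.2 ⟨_, hNy, fun A hA hA0 => ?_⟩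
    replace hA0 : hypersurfaceVolume A ≠ 0 := hA0
    rw [hypersurfaceVolume_eq hm] at hA0
    rw [hypersurfaceVolume_eq hm, hypersurfaceVolume_eq hm]
    -- All three volumes to be compared are those of images of the coordinate set `S`, on which `N`
    -- provides every local estimate.
    set S := {p | p ∈ N ∧ y.shift p ∈ A} with hS
    have hAS : A = y.shift '' S := by
      refine Subset.antisymm (fun z hz => ?_) (by rintro _ ⟨p, hp, rfl⟩; exact hp.2)
      obtain ⟨⟨p, hp, rfl⟩, -⟩ := hA hz
      exact ⟨p, ⟨hp, hz⟩, rfl⟩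
    have hflow : flow D t '' A = (fun p => y'.shift (G p)) '' S := by
      rw [hAS, image_image]
      exact image_congr fun p hp => hp.1.2.2.2.2
    have hΦS : ∀ p ∈ S, Φ p = 0 := fun p hp => hp.1.2.2.2.1.2 (hA hp.2).2
    have hcompS : ∀ p ∈ S, ∀ p' ∈ S, _ := fun p hp p' hp' =>
      hcompU (mk_mem_prod hp.1.1 hp'.1.1) (hΦS p hp) (hΦS p' hp')
    have hK0 : 0 ≤ K := by linarith
    have hscale : μH[m] ((fun p => fderiv ℝ G 0 (P p)) '' S) =
        ENNReal.ofReal (‖w‖ / ‖n‖) * μH[m] (P '' S) := by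
      rw [← h.hausdorffMeasure_image_hypersurface hm hv0 (hv'.trans hv.symm) hn.1 hw (E := P '' S),
        image_image]
      rintro _ ⟨p, -, rfl⟩
      obtain ⟨ξ, hξ, hξT⟩ := hker _ (apply_kerProj p)
      exact ⟨ξ, hξ, (hn.2 ξ).1 hξT⟩
    rw [hflow]
    refine le_div_and_div_le_of_comparison (b := μH[m] (P '' S)) ?_ ENNReal.ofReal_ne_top hA0
      (hausdorffMeasure_kerProj_image_ne_top hrank fun p hp => hp.1.2.1) ?_ ?_ ?_ ?_
    · rw [Ne, ENNReal.ofReal_eq_zero, not_le]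
      positivity
    · conv_lhs => rw [hAS]
      refine hausdorffMeasure_image_le_of_dist_le hK0 (fun p hp p' hp' => ?_) m
      rw [hdist y p p' hp.1.2.1 hp'.1.2.1]
      exact (hcompS p hp p' hp').1
    · have := hausdorffMeasure_image_le_of_dist_le (S := S) (a := y.shift) (b := P) zero_le_one
        (fun p hp p' hp' => by
          rw [hdist y p p' hp.1.2.1 hp'.1.2.1, one_mul]
          exact hdistP p p') m
      rwa [one_pow, ENNReal.ofReal_one, one_mul, ← hAS] at this
    · rw [← hscale]
      refine hausdorffMeasure_image_le_of_dist_le hK0 (fun p hp p' hp' => ?_) m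
      rw [hdist y' _ _ hp.1.2.2.1 hp'.1.2.2.1]
      exact (hcompS p hp p' hp').2.1
    · rw [← hscale]
      refine hausdorffMeasure_image_le_of_dist_le hK0 (fun p hp p' hp' => ?_) m
      rw [hdist y' _ _ hp.1.2.2.1 hp'.1.2.2.1]
      exact (hcompS p hp p' hp').2.2

lemma isNormalVector_map (A : tangentSpace y ≃ₗ[ℝ] tangentSpace y')
    {T : Submodule ℝ (tangentSpace y)} {n : tangentSpace y} (hn : IsNormalVector T n)
    {w : tangentSpace y'} (hw : ∀ ξ, ⟪A ξ, w⟫ = ⟪ξ, n⟫) :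
    IsNormalVector (T.map A.toLinearMap) w := by
  refine ⟨fun h0 => hn.1 ?_, fun ξ => ?_⟩
  · have := hw n
    rwa [h0, inner_zero_right, eq_comm, inner_self_eq_zero] at this
  · obtain ⟨η, rfl⟩ := A.surjective ξ
    rw [hw, ← hn.2, Submodule.mem_map]
    refine ⟨?_, fun h => ⟨η, h, rfl⟩⟩
    rintro ⟨ζ, hζ, h⟩
    rwa [← A.injective h]

/-- This relation is all that is used about the transported normal vector. -/
lemma inner_apply_eq_of_eq_adjoint_symm (A : tangentSpace y ≃ₗ[ℝ] tangentSpace y')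
    {n : tangentSpace y} {w : tangentSpace y'}
    (hw : w = LinearMap.adjoint (𝕜 := ℝ) A.symm.toLinearMap n) (ξ : tangentSpace y) :
    ⟪A ξ, w⟫ = ⟪ξ, n⟫ := by
  rw [hw, LinearMap.adjoint_inner_right]
  exact congrArg (fun z => ⟪z, n⟫) (A.symm_apply_apply ξ)

end Volume

end Billiard

open Billiard in
theorem mainTheorem2 (d : ℕ) (L : AddSubgroup (Euc d)) [DiscreteTopology L]
    (D : Set (Euc d ⧸ L)) (hD : IsOpen D)
    (J : Set (Phase L)) (hJ : J ⊆ phaseSpace D)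
    (y₀ : Phase L) (T₀ : Submodule ℝ (tangentSpace y₀)) (hT₀ : IsHypersurfaceAt J y₀ T₀)
    (n₀ : tangentSpace y₀) (hn₀ : IsNormalVector T₀ n₀)
    (t : ℝ) (hy₀ : y₀ ∈ flowDomain D t)
    (yt : Phase L) (hyt : yt = flow D t y₀) :
    ∃ A : tangentSpace y₀ ≃ₗ[ℝ] tangentSpace yt,
      HasTangentMapAt (flow D t) y₀ yt A.toLinearMap ∧
      HasTangentMapAt (flow D (-t)) yt y₀ A.symm.toLinearMap ∧
      ∃ nt : tangentSpace yt,
        nt = LinearMap.adjoint (𝕜 := ℝ) A.symm.toLinearMap n₀ ∧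
        IsHypersurfaceAt (flowImage D t J) yt (T₀.map A.toLinearMap) ∧
        IsNormalVector (T₀.map A.toLinearMap) nt ∧
        ExpandsVolumeAt (flow D t) J y₀ (‖nt‖ / ‖n₀‖) := by
  have hflow : FlowsTo D t y₀ yt := hyt ▸ flowsTo_flow hy₀
  obtain ⟨G, H, h⟩ := hflow.exists_isFlowChart hD
  obtain ⟨nt, hnt⟩ : ∃ nt : tangentSpace yt,
      nt = LinearMap.adjoint (𝕜 := ℝ) h.tangentEquiv.symm.toLinearMap n₀ :=
    ⟨_, rfl⟩
  have hw := inner_apply_eq_of_eq_adjoint_symm h.tangentEquiv hnt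
  exact ⟨h.tangentEquiv, h.hasTangentMapAt, h.symm.hasTangentMapAt, nt, hnt,
    h.isHypersurfaceAt hJ hT₀, isNormalVector_map h.tangentEquiv hn₀ hw,
    h.expandsVolumeAt hy₀.1.2 (hflow.norm_snd.trans hy₀.1.2) hJ hT₀ hn₀ hw⟩
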